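/- Setting. Let $(E,\mathcal E)$ be a Blackwell space (a countably generated measurable space separating points, such that $f(E)$ is analytic for every measurable $f:E\to\mathbb R$), and let $(\Omega,\mathcal F,P)$ be a probability space carrying a marked point process with values in $E$: random times $0=T_0<T_1<T_2<\cdots$ in $[0,\infty]$ (strictly increasing as long as they are finite, and $T_{n+1}=\infty$ if $T_n=\infty$), with $T_n\to\infty$ almost surely, and random locations $\xi_0,\xi_1,\xi_2,\dots$ in $E$ with $\xi_0$ deterministic and $\xi_{n+1}\ne\xi_n$ whenever $T_{n+1}<\infty$. Let $X_t=\xi_n$ for $T_n\le t<T_{n+1}$, let $\mathcal F_t=\sigma(X_s;\,s\le t)\vee\{\text{null sets}\}$, and, for $\alpha\ge1$, let $\mu^\alpha(\omega;\cdot)$ be any regular conditional distribution of $(T_\alpha,\xi_\alpha)$ on $[0,\infty]\times E$ given $\mathcal F_{T_{\alpha-1}}$. Put $F^\alpha_t(A)=\mu^\alpha(]t,\infty]\times A)$, $F^\alpha_t=F^\alpha_t(E)$ and \[ p^\alpha(t,A)=1_{\{t\ge T_\alpha\}}1_{\{\xi_\alpha\in A\}},\qquad \tilde p^\alpha(t,A)=-\int_{]0,t\wedge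 T_\alpha]}(F^\alpha_{u-})^{-1}\,dF^\alpha_u(A), \] let $p=\sum_{\alpha\ge1}p^\alpha$ and $\tilde p=\sum_{\alpha\ge1}\tilde p^\alpha$ be the corresponding random measures on $]0,\infty[\,\times E$, and $q=p-\tilde p=\sum_{\alpha\ge 1}(p^\alpha-\tilde p^\alpha)$. Theorem. Let $M=(M_t)_{t\ge0}$ be a real $\{\mathcal F_t\}$-martingale with $\mathbb E[M_t^2]<\infty$ for every $t$. Then there is an $\{\mathcal F_t\}$-predictable process $g(\omega,t,x)$ (measurable with respect to the product of the predictable $\sigma$-algebra and $\mathcal E$) such that, almost surely, for every $t\ge 0$, $g$ is integrable on $]0,t]\times E$ with respect to both $p$ and $\tilde p$, and, for every $t\ge0$, \[ M_t=M_0+\int_{]0,t]\times E}g(s,x)\,q(ds,dx)\qquad\text{almost surely.} \] If moreover $M$ has almost surely right-continuous paths, then almost surely this identity holds for all $t\ge0$ simultaneously. -/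

import Mathlib

open MeasureTheory Set Filter Topology
open scoped NNReal ENNReal

/-- A Blackwell space: a countably generated measurable space that separates points and whose
image under every measurable real function is an analytic set. Equivalently, a measurable space
isomorphic to an analytic subset of the real line with its Borel σ-algebra. -/
class BlackwellSpace (E : Type*) [MeasurableSpace E] : Prop extends
    MeasurableSpace.CountablyGenerated E, MeasurableSpace.SeparatesPoints E where
  analyticSet_range : ∀ f : E → ℝ, Measurable f → AnalyticSet (range f)

/-- The jump times `T 1 < T 2 < ...` and successive locations `ξ 0, ξ 1, ξ 2, ...` of a
right-constant jump process in `E` that starts at the fixed point `x₀` and almost surely has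
finitely many jumps in bounded time. The value `T n ω = ∞` means that the `n`-th jump does not
occur; then `ξ n ω` is irrelevant. The convention `T 0 = 0` is used. -/
structure MarkedPointProcess {Ω : Type*} [MeasurableSpace Ω] (P : Measure Ω)
    (E : Type*) [MeasurableSpace E] where
  T : ℕ → Ω → ℝ≥0∞
  ξ : ℕ → Ω → E
  x₀ : E
  measurable_T : ∀ n, Measurable (T n)
  measurable_ξ : ∀ n, Measurable (ξ n)
  T_zero : ∀ ω, T 0 ω = 0
  ξ_zero : ∀ ω, ξ 0 ω = x₀
  T_mono : ∀ ω, Monotone (fun n => T n ω)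
  T_lt : ∀ n ω, T n ω ≠ ∞ → T n ω < T (n + 1) ω
  ξ_ne : ∀ n ω, T (n + 1) ω ≠ ∞ → ξ (n + 1) ω ≠ ξ n ω
  tendsto_T : ∀ᵐ ω ∂P, Tendsto (fun n => T n ω) atTop (𝓝 ∞)

namespace MarkedPointProcess

variable {Ω E : Type*} [mΩ : MeasurableSpace Ω] [mE : MeasurableSpace E] {P : Measure Ω}

/-- The number of jumps up to time `t` (with the junk value `0` on the null set of paths with
infinitely many jumps up to `t`). -/
noncomputable def numJumps (X : MarkedPointProcess P E) (t : ℝ≥0) (ω : Ω) : ℕ :=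
  sSup {n : ℕ | X.T n ω ≤ t}

/-- The jump process `X_t`, equal to `ξ n` for `T n ≤ t < T (n + 1)`. -/
noncomputable def path (X : MarkedPointProcess P E) (t : ℝ≥0) (ω : Ω) : E :=
  X.ξ (X.numJumps t ω) ω

theorem numJumps_eq (X : MarkedPointProcess P E) {t : ℝ≥0} {ω : Ω} {n : ℕ}
    (h : X.T n ω ≤ t) (h' : t < X.T (n + 1) ω) : X.numJumps t ω = n := by
  have : {k : ℕ | X.T k ω ≤ t} = Iic n := by
    ext k
    refine ⟨fun hk => ?_, fun hk => (X.T_mono ω hk).trans h⟩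
    by_contra hkn
    have hkn' : n + 1 ≤ k := by simpa using hkn
    exact absurd (h'.trans_le ((X.T_mono ω hkn').trans hk)) (lt_irrefl _)
  rw [numJumps, this]
  exact csSup_Iic

theorem numJumps_eq_zero (X : MarkedPointProcess P E) {t : ℝ≥0} {ω : Ω}
    (h : ∀ n, X.T n ω ≤ t) : X.numJumps t ω = 0 := by
  have : {k : ℕ | X.T k ω ≤ t} = univ := by ext k; simp [h k]
  rw [numJumps, this]
  exact Nat.sSup_of_not_bddAbove not_bddAbove_univ

theorem exists_le_lt_or (X : MarkedPointProcess P E) (t : ℝ≥0) (ω : Ω) :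
    (∃ n, X.T n ω ≤ t ∧ t < X.T (n + 1) ω) ∨ ∀ n, X.T n ω ≤ t := by
  by_cases h : ∀ n, X.T n ω ≤ t
  · exact Or.inr h
  · left
    by_contra! hc
    apply h
    intro n
    induction n with
    | zero => simp [X.T_zero]
    | succ k ih => exact hc k ih

theorem measurable_numJumps (X : MarkedPointProcess P E) (t : ℝ≥0) :
    Measurable (X.numJumps t) := by
  refine measurable_to_countable' fun k => ?_
  have : X.numJumps t ⁻¹' {k} =
      ({ω | X.T k ω ≤ t} ∩ {ω | t < X.T (k + 1) ω}) ∪ ({_ω | k = 0} ∩ ⋂ n, {ω | X.T n ω ≤ t}) := by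
    ext ω
    simp only [mem_preimage, mem_singleton_iff, mem_union, mem_inter_iff, mem_ofPred_eq, mem_iInter]
    constructor
    · intro h
      rcases X.exists_le_lt_or t ω with ⟨n, h1, h2⟩ | h1
      · rw [X.numJumps_eq h1 h2] at h
        subst h
        exact Or.inl ⟨h1, h2⟩
      · rw [X.numJumps_eq_zero h1] at h
        exact Or.inr ⟨h.symm, h1⟩
    · rintro (⟨h1, h2⟩ | ⟨h1, h2⟩)
      · exact X.numJumps_eq h1 h2
      · rw [X.numJumps_eq_zero h2, h1]
  rw [this]
  exact ((measurableSet_le (X.measurable_T k) measurable_const).inter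
    (measurableSet_lt measurable_const (X.measurable_T (k + 1)))).union
    ((MeasurableSet.const _).inter
      (MeasurableSet.iInter fun n => measurableSet_le (X.measurable_T n) measurable_const))

theorem measurable_path (X : MarkedPointProcess P E) (t : ℝ≥0) : Measurable (X.path t) := by
  have h : Measurable (fun p : ℕ × Ω => X.ξ p.1 p.2) :=
    measurable_from_prod_countable_right fun n => X.measurable_ξ n
  exact h.comp ((X.measurable_numJumps t).prodMk measurable_id)

/-- The filtration `F_t = σ(X_s; s ≤ t) ∨ {null sets}`. The null sets are those of the σ-algebra
on which `P` is given, which are all `P`-null sets if `P` is complete. -/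
noncomputable def filtration (X : MarkedPointProcess P E) :
    Filtration ℝ≥0 mΩ where
  seq t := (⨆ s ∈ Iic t, MeasurableSpace.comap (X.path s) mE) ⊔
    MeasurableSpace.generateFrom {N | MeasurableSet N ∧ P N = 0}
  mono' _ _ h := sup_le_sup_right (biSup_mono fun _ hs => le_trans hs h) _
  le' _ := sup_le (iSup₂_le fun s _ => (X.measurable_path s).comap_le)
    (MeasurableSpace.generateFrom_le fun _ hN => hN.1)

theorem measurable_path_filtration (X : MarkedPointProcess P E) {s t : ℝ≥0} (h : s ≤ t) :
    Measurable[X.filtration t] (X.path s) := by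
  rw [measurable_iff_comap_le]
  exact le_sup_of_le_left (le_iSup₂_of_le s h le_rfl)

theorem measurableSet_filtration_of_null (X : MarkedPointProcess P E) {t : ℝ≥0} {N : Set Ω}
    (h : MeasurableSet N) (h0 : P N = 0) : MeasurableSet[X.filtration t] N :=
  (le_sup_right : _ ≤ X.filtration t) _ (MeasurableSpace.measurableSet_generateFrom ⟨h, h0⟩)

theorem measurableSet_path_ne [BlackwellSpace E] (X : MarkedPointProcess P E) {r s t : ℝ≥0}
    (hr : r ≤ t) (hs : s ≤ t) :
    MeasurableSet[X.filtration t] {ω | X.path r ω ≠ X.path s ω} := by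
  have hm := MeasurableSpace.measurable_mapNatBool E
  have hi := MeasurableSpace.injective_mapNatBool E
  have hr' := hm.comp (X.measurable_path_filtration hr)
  have hs' := hm.comp (X.measurable_path_filtration hs)
  have hp := hr'.prodMk hs'
  exact (hp measurableSet_diagonal).compl.congr (by ext ω; simp [hi.eq_iff])

/-- Jump times are stopping times. -/
theorem isStoppingTime_T [BlackwellSpace E] (X : MarkedPointProcess P E) (n : ℕ) :
    IsStoppingTime X.filtration (X.T n) := by
  induction n with
  | zero => intro t; simp [X.T_zero]
  | succ n ih =>
    intro t
    obtain ⟨N, hN, hNm, hN0⟩ := exists_measurable_superset_of_null (ae_iff.1 X.tendsto_T)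
    let D : Set ℝ≥0 := {r | r ≤ t ∧ (r = t ∨ ∃ q : ℚ, (r : ℝ) = q)}
    have hD : D.Countable := by
      have h1 : (NNReal.toReal ⁻¹' range ((↑) : ℚ → ℝ)).Countable :=
        (countable_range _).preimage_of_injOn NNReal.coe_injective.injOn
      refine (h1.union (countable_singleton t)).mono ?_
      rintro r ⟨-, rfl | ⟨q, hq⟩⟩
      · exact Or.inr rfl
      · exact Or.inl ⟨q, hq.symm⟩
    -- a point of `D` between two consecutive jump times
    have hpt : ∀ ω k, X.T k ω ≤ t → ∃ r ∈ D, X.T k ω ≤ r ∧ r < X.T (k + 1) ω := by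
      intro ω k hk
      rcases lt_or_ge (t : ℝ≥0∞) (X.T (k + 1) ω) with h | h
      · exact ⟨t, ⟨le_rfl, Or.inl rfl⟩, hk, h⟩
      · obtain ⟨q, hq0, h1, h2⟩ :=
          ENNReal.lt_iff_exists_rat_btwn.1 (X.T_lt k ω (ne_top_of_le_ne_top ENNReal.coe_ne_top hk))
        refine ⟨Real.toNNReal q, ⟨?_, Or.inr ⟨q, ?_⟩⟩, h1.le, h2⟩
        · exact_mod_cast (h2.trans_le h).le
        · exact Real.coe_toNNReal _ (by exact_mod_cast hq0)
    let B : Set Ω := ⋃ r ∈ D, ⋃ s ∈ {s | s ∈ D ∧ r ≤ s},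
      ({ω | X.T n ω ≤ r} ∩ {ω | X.path r ω ≠ X.path s ω})
    have hB : MeasurableSet[X.filtration t] B := by
      refine MeasurableSet.biUnion hD fun r hr => ?_
      refine MeasurableSet.biUnion (hD.mono fun s hs => hs.1) fun s hs => ?_
      exact (X.filtration.mono hr.1 _ (ih r)).inter (X.measurableSet_path_ne hr.1 hs.1.1)
    have key : ∀ ω ∉ N, (X.T (n + 1) ω ≤ t ↔ ω ∈ B) := by
      intro ω hω
      have hlim : Tendsto (fun n => X.T n ω) atTop (𝓝 ∞) := by
        by_contra h
        exact hω (hN h)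
      have hfin : ∀ s : ℝ≥0, ∃ k, X.T k ω ≤ s ∧ s < X.T (k + 1) ω := by
        intro s
        rcases X.exists_le_lt_or s ω with h | h
        · exact h
        · exact absurd (le_of_tendsto' hlim h) (by simp)
      simp only [B, mem_iUnion, mem_inter_iff, mem_ofPred_eq, exists_prop]
      constructor
      · intro h
        obtain ⟨r, hr, hr1, hr2⟩ := hpt ω n ((X.T_mono ω n.le_succ).trans h)
        obtain ⟨s, hs, hs1, hs2⟩ := hpt ω (n + 1) h
        refine ⟨r, hr, s, ⟨hs, ?_⟩, hr1, ?_⟩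
        · exact_mod_cast (hr2.trans_le hs1).le
        · rw [path, path, X.numJumps_eq hr1 hr2, X.numJumps_eq hs1 hs2]
          exact (X.ξ_ne n ω (ne_top_of_le_ne_top ENNReal.coe_ne_top h)).symm
      · rintro ⟨r, hr, s, ⟨hs, hrs⟩, hr1, hne⟩
        obtain ⟨j, hj1, hj2⟩ := hfin r
        obtain ⟨k, hk1, hk2⟩ := hfin s
        have hnj : n ≤ j := by
          by_contra! h
          exact absurd (hj2.trans_le ((X.T_mono ω h).trans hr1)) (lt_irrefl _)
        have hjk : j ≠ k := by
          rintro rfl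
          exact hne (by rw [path, path, X.numJumps_eq hj1 hj2, X.numJumps_eq hk1 hk2])
        have hjk' : j ≤ k := by
          by_contra! h
          have h3 : (r : ℝ≥0∞) ≤ s := by exact_mod_cast hrs
          exact absurd (hk2.trans_le ((X.T_mono ω h).trans (hj1.trans h3))) (lt_irrefl _)
        have h4 : (s : ℝ≥0∞) ≤ t := by exact_mod_cast hs.1
        exact (X.T_mono ω (show n + 1 ≤ k by omega)).trans (hk1.trans h4)
    have hset : {ω | X.T (n + 1) ω ≤ t} = (B \ N) ∪ ({ω | X.T (n + 1) ω ≤ t} ∩ N) := by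
      ext ω
      by_cases hω : ω ∈ N
      · simp [hω]
      · simp [hω, key ω hω]
    suffices MeasurableSet[X.filtration t] {ω | X.T (n + 1) ω ≤ (t : ℝ≥0∞)} from this
    rw [hset]
    refine (hB.diff (X.measurableSet_filtration_of_null hNm hN0)).union
      (X.measurableSet_filtration_of_null
        ((measurableSet_le (X.measurable_T _) measurable_const).inter hNm)
        (measure_mono_null inter_subset_right hN0))

/-- The σ-algebra `F_{T_n}` of events up to the `n`-th jump time. -/
noncomputable abbrev jumpSigma [BlackwellSpace E] (X : MarkedPointProcess P E) (n : ℕ) :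
    MeasurableSpace Ω :=
  (X.isStoppingTime_T n).measurableSpace

/-- `κ` is a regular conditional probability distribution of `(T (n + 1), ξ (n + 1))`
given `F_{T_n}`. -/
structure IsRegularJumpLaw [BlackwellSpace E] (X : MarkedPointProcess P E) (n : ℕ)
    (κ : Ω → Measure (ℝ≥0∞ × E)) : Prop where
  isProbabilityMeasure : ∀ ω, IsProbabilityMeasure (κ ω)
  measurable : ∀ B, MeasurableSet B → Measurable[X.jumpSigma n] fun ω => κ ω B
  setLIntegral : ∀ A, MeasurableSet[X.jumpSigma n] A → ∀ B, MeasurableSet B →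
    ∫⁻ ω in A, κ ω B ∂P = P (A ∩ {ω | (X.T (n + 1) ω, X.ξ (n + 1) ω) ∈ B})

open scoped Classical in
/-- The measure `p^α`, `α = n + 1`, on space-time: the unit mass at `(T_α, ξ_α)`,
so that `p^α(]0,t] × A) = 1_{t ≥ T_α} 1_{ξ_α ∈ A}`. -/
noncomputable def jumpMeasure (X : MarkedPointProcess P E) (n : ℕ) (ω : Ω) :
    Measure (ℝ≥0 × E) :=
  if X.T (n + 1) ω = ∞ then 0 else Measure.dirac ((X.T (n + 1) ω).toNNReal, X.ξ (n + 1) ω)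

/-- The survival function `F_t(A) = μ(]t,∞] × A)` of a law `μ` on `[0,∞] × E`. -/
noncomputable def survival (μ : Measure (ℝ≥0∞ × E)) (t : ℝ≥0) (A : Set E) : ℝ≥0∞ :=
  μ (Ioi (t : ℝ≥0∞) ×ˢ A)

/-- `F_{t-} = μ([t,∞] × E)`, the left limit of `F_t(E)`. -/
noncomputable def survivalLeft (μ : Measure (ℝ≥0∞ × E)) (t : ℝ≥0) : ℝ≥0∞ :=
  μ (Ici (t : ℝ≥0∞) ×ˢ univ)

theorem tendsto_survival_survivalLeft (μ : Measure (ℝ≥0∞ × E)) [IsFiniteMeasure μ] {t : ℝ≥0}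
    (ht : 0 < t) :
    Tendsto (fun s => survival μ s univ) (𝓝[<] t) (𝓝 (survivalLeft μ t)) := by
  have h : (⋂ s : ℝ≥0ᵒᵈ, ⋂ _ : s > OrderDual.toDual t,
      Ioi ((OrderDual.ofDual s : ℝ≥0) : ℝ≥0∞) ×ˢ (univ : Set E)) = Ici (t : ℝ≥0∞) ×ˢ univ := by
    ext ⟨u, x⟩
    simp only [mem_iInter, mem_prod, mem_Ioi, mem_univ, and_true, mem_Ici]
    refine ⟨fun hu => ?_, fun hu s hs => lt_of_lt_of_le (ENNReal.coe_lt_coe.2 hs) hu⟩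
    refine le_of_forall_lt fun a ha => ?_
    lift a to ℝ≥0 using ne_top_of_lt ha
    exact hu (OrderDual.toDual a) (ENNReal.coe_lt_coe.1 ha)
  have key := tendsto_measure_biInter_gt (μ := μ) (ι := ℝ≥0ᵒᵈ) (a := OrderDual.toDual t)
    (s := fun s => Ioi ((OrderDual.ofDual s : ℝ≥0) : ℝ≥0∞) ×ˢ (univ : Set E))
    (fun s _ => (measurableSet_Ioi.prod MeasurableSet.univ).nullMeasurableSet)
    (fun i j _ hij => prod_mono (Ioi_subset_Ioi (ENNReal.coe_le_coe.2 hij)) Subset.rfl)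
    ⟨OrderDual.toDual 0, ht, measure_ne_top _ _⟩
  rw [h] at key
  exact key

/-- The measure `A ↦ -dF_t(A)` on `[0,∞[ × E`: the restriction of `μ` to finite times. -/
noncomputable def finiteTimePart (μ : Measure (ℝ≥0∞ × E)) : Measure (ℝ≥0 × E) :=
  μ.comap (Prod.map ((↑) : ℝ≥0 → ℝ≥0∞) id)

/-- The compensator `p̃^α`, `α = n + 1`, where `κ n` is the conditional law of
`(T_α, ξ_α)` given `F_{T_{α-1}}`:
`p̃^α(]0,t] × A) = -∫_{]0, t ∧ T_α]} (F^α_{u-})⁻¹ dF^α_u(A)`. -/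
noncomputable def compensator (X : MarkedPointProcess P E) (κ : ℕ → Ω → Measure (ℝ≥0∞ × E))
    (n : ℕ) (ω : Ω) : Measure (ℝ≥0 × E) :=
  ((finiteTimePart (κ n ω)).withDensity fun z => (survivalLeft (κ n ω) z.1)⁻¹).restrict
    ({u : ℝ≥0 | 0 < u ∧ (u : ℝ≥0∞) ≤ X.T (n + 1) ω} ×ˢ univ)

/-- The sum `p = ∑ p^α` over all jumps. -/
noncomputable def totalJumpMeasure (X : MarkedPointProcess P E) (ω : Ω) : Measure (ℝ≥0 × E) :=
  Measure.sum fun n => X.jumpMeasure n ω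

/-- The sum `p̃ = ∑ p̃^α` over all jumps. -/
noncomputable def totalCompensator (X : MarkedPointProcess P E)
    (κ : ℕ → Ω → Measure (ℝ≥0∞ × E)) (ω : Ω) : Measure (ℝ≥0 × E) :=
  Measure.sum fun n => X.compensator κ n ω

/-- `f` is integrable on `]0,t] × E` with respect to `q = p - p̃`, i.e. with respect to both
`p` and `p̃`. -/
def QIntegrable (X : MarkedPointProcess P E) (κ : ℕ → Ω → Measure (ℝ≥0∞ × E)) (ω : Ω)
    (t : ℝ≥0) (f : ℝ≥0 × E → ℝ) : Prop :=
  IntegrableOn f (Ioc 0 t ×ˢ univ) (X.totalJumpMeasure ω) ∧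
    IntegrableOn f (Ioc 0 t ×ˢ univ) (X.totalCompensator κ ω)

/-- The integral `∫_{]0,t] × E} f dq`, where `q = p - p̃`. -/
noncomputable def qIntegral (X : MarkedPointProcess P E) (κ : ℕ → Ω → Measure (ℝ≥0∞ × E)) (ω : Ω)
    (t : ℝ≥0) (f : ℝ≥0 × E → ℝ) : ℝ :=
  (∫ z in Ioc 0 t ×ˢ univ, f z ∂(X.totalJumpMeasure ω)) -
    ∫ z in Ioc 0 t ×ˢ univ, f z ∂(X.totalCompensator κ ω)

/-- The process `g(ω,t,x)` is predictable: measurable for the product of the predictable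
σ-algebra of `X` on `[0,∞[ × Ω` and the σ-algebra of `E`. -/
def IsPredictable (X : MarkedPointProcess P E) (g : ℝ≥0 → Ω → E → ℝ) : Prop :=
  Measurable[X.filtration.predictable.prod mE]
    fun z : (ℝ≥0 × Ω) × E => g z.1.1 z.1.2 z.2

end MarkedPointProcess

/-! Fix an integrable `Y`, later `Y = M N`. Before the jump `n + 1`, the history of the process
consists of the first `n` jumps and of the fact that the next one has not yet occurred. By
Doob-Dynkin, the conditional expectation of `Y` given the first `n + 1` jumps is `h n (ω, (T (n +
1), ξ (n + 1)))`, where `h n` sees `ω` only through the past. Let `y n` be the conditional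
expectation given the first `n` jumps, and let `c n t` be the mean of `h n` under the law of the
next jump restricted to `]t,∞]` (`condMean`). Then `E[Y | F_t] = c n t` for `T n ≤ t < T (n + 1)`
(`ae_condExp_filtration_eq`), and `h n` has mean `y n` under the law of the next jump
(`ae_integral_eq`).

The integrand is `h n (t, x) - c n t` on `]T n, T (n + 1)]`. Its `p`-integral gains `y (k + 1) - c k
(T (k + 1))` at the jump `k + 1`; its integral against the compensator of that jump is `y k - c k (t
∧ T (k + 1))` (`integral_hazard`). The difference of the two sums telescopes to `c n t - y 0`, which
is the representation of `E[Y | F_t]` (`IsRegularPath.qIntegral_eq`).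

The compensator integral is a statement about one fixed law, `lintegral_add_lintegral_condTail`. It
follows by Fubini from `d(1/F) = -dF / (F F_-)`, which holds for laws with atoms too
(`one_add_lintegral_inv_mul_inv`).

A martingale on `[0,∞[` need not be closed by one variable, so the integrands obtained from `M 1, M
2, ...` are glued along the intervals `]k, k + 1]`. -/

set_option linter.unusedSectionVars false

/-! ### Stieltjes calculus of survival functions. -/

section LinearOrder

variable {α : Type*} [LinearOrder α] [TopologicalSpace α] [OrderTopology α]
  [MeasurableSpace α] [BorelSpace α]

theorem measurable_measure_Iic (ν : Measure α) : Measurable fun s => ν (Iic s) :=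
  Monotone.measurable fun _ _ h => measure_mono (Iic_subset_Iic.2 h)

theorem measurable_measure_Iio (ν : Measure α) : Measurable fun s => ν (Iio s) :=
  Monotone.measurable fun _ _ h => measure_mono (Iio_subset_Iio h)

theorem measurable_measure_Ioi (ν : Measure α) : Measurable fun s => ν (Ioi s) :=
  Antitone.measurable fun _ _ h => measure_mono (Ioi_subset_Ioi h)

theorem measurable_measure_Ici (ν : Measure α) : Measurable fun s => ν (Ici s) :=
  Antitone.measurable fun _ _ h => measure_mono (Ici_subset_Ici.2 h)

/-- The sum `∑ a ^ i * b ^ j` over `i + j = k`, where `a` and `b` are the distribution function of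
`ν` and its left limit. -/
noncomputable def cdfPowSum (ν : Measure α) (k : ℕ) (s : α) : ℝ≥0∞ :=
  ∑ ij ∈ Finset.HasAntidiagonal.antidiagonal k, ν (Iic s) ^ ij.1 * ν (Iio s) ^ ij.2

theorem measurable_cdfPowSum (ν : Measure α) (k : ℕ) : Measurable (cdfPowSum ν k) :=
  Finset.measurable_sum _ fun _ _ =>
    ((measurable_measure_Iic ν).pow_const _).mul ((measurable_measure_Iio ν).pow_const _)

theorem cdfPowSum_succ (ν : Measure α) (k : ℕ) (s : α) :
    cdfPowSum ν (k + 1) s = cdfPowSum ν k s * ν (Iio s) + ν (Iic s) ^ (k + 1) := by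
  simp only [cdfPowSum]
  rw [Finset.Nat.sum_antidiagonal_succ', Finset.sum_mul, add_comm]
  simp [pow_succ, mul_assoc]

/-- Product of two geometric series, regrouped along antidiagonals. In `ℝ≥0∞` it stays true, with
value `∞`, where a distribution function reaches `1`. -/
theorem tsum_cdfPowSum (ν : Measure α) (s : α) :
    ∑' k, cdfPowSum ν k s = (1 - ν (Iic s))⁻¹ * (1 - ν (Iio s))⁻¹ := by
  have h1 : ∑' p : ℕ × ℕ, ν (Iic s) ^ p.1 * ν (Iio s) ^ p.2 =
      (1 - ν (Iic s))⁻¹ * (1 - ν (Iio s))⁻¹ := by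
    rw [ENNReal.tsum_prod (f := fun i j => ν (Iic s) ^ i * ν (Iio s) ^ j)]
    simp_rw [ENNReal.tsum_mul_left, ENNReal.tsum_mul_right, ENNReal.tsum_geometric]
  rw [← h1, ← (Finset.HasAntidiagonal.sigmaAntidiagonalEquivProd (A := ℕ)).tsum_eq, ENNReal.tsum_sigma']
  refine tsum_congr fun k => ?_
  rw [cdfPowSum, tsum_fintype, ← Finset.sum_coe_sort (Finset.HasAntidiagonal.antidiagonal k)
    (fun ij : ℕ × ℕ => ν (Iic s) ^ ij.1 * ν (Iio s) ^ ij.2)]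
  rfl

variable [SecondCountableTopology α]

/-- The power rule `d(F ^ (k + 1)) = (∑ F ^ i * F_- ^ j) dF`, where the mixed sum accounts for
atoms. For the induction, `L` is split at `s`; after Fubini the part above `s` is the induction
hypothesis on `Iic u`, and `cdfPowSum_succ` recombines the two parts. Lower sets cover open and
closed half-lines at once. -/
theorem measure_pow_succ_eq_lintegral (ν : Measure α) [IsFiniteMeasure ν] (k : ℕ) {L : Set α}
    (hL : MeasurableSet L) (hlow : IsLowerSet L) :
    ν L ^ (k + 1) = ∫⁻ s in L, cdfPowSum ν k s ∂ν := by
  induction k generalizing L with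
  | zero => simp [cdfPowSum]
  | succ k ih =>
    have hS := measurable_cdfPowSum ν k
    have hSm : Measurable fun s => cdfPowSum ν k s * ν (Iio s) := hS.mul (measurable_measure_Iio ν)
    have h1 : ∀ s ∈ L, cdfPowSum ν k s * ν L = cdfPowSum ν k s * ν (Iio s) +
        ∫⁻ u in L, (Iic u).indicator (cdfPowSum ν k) s ∂ν := by
      intro s hs
      have : ∀ u, (Iic u).indicator (cdfPowSum ν k) s
          = (Ici s).indicator (fun _ => cdfPowSum ν k s) u := fun u => by
        simp [indicator]
      simp_rw [this]
      rw [lintegral_indicator measurableSet_Ici, setLIntegral_const,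
        Measure.restrict_apply measurableSet_Ici, ← mul_add]
      congr 1
      rw [← measure_union _ (measurableSet_Ici.inter hL)]
      · congr 1
        ext u
        simp only [mem_union, mem_Iio, mem_inter_iff, mem_Ici]
        exact ⟨fun h => (lt_or_ge u s).imp id fun h' => ⟨h', h⟩,
          fun h => h.elim (fun h => hlow h.le hs) fun h => h.2⟩
      · exact Set.disjoint_left.2 fun u hu hu' => absurd hu'.1 (not_le.2 hu)
    rw [pow_succ, ih hL hlow, ← lintegral_mul_const _ hS, setLIntegral_congr_fun hL h1,
      lintegral_add_left hSm, lintegral_lintegral_swap]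
    · have h2 : ∀ u ∈ L, ∫⁻ s in L, (Iic u).indicator (cdfPowSum ν k) s ∂ν
          = ν (Iic u) ^ (k + 1) := by
        intro u hu
        rw [lintegral_indicator measurableSet_Iic, Measure.restrict_restrict measurableSet_Iic,
          (inter_eq_left.2 fun s hs => hlow hs hu : Iic u ∩ L = Iic u), ih measurableSet_Iic (isLowerSet_Iic u)]
      rw [setLIntegral_congr_fun hL h2, ← lintegral_add_left hSm]
      simp_rw [cdfPowSum_succ]
    · refine Measurable.aemeasurable ?_
      have : (Function.uncurry fun s u => (Iic u).indicator (cdfPowSum ν k) s)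
          = {p : α × α | p.1 ≤ p.2}.indicator (fun p => cdfPowSum ν k p.1) := by
        ext p
        simp [indicator, Function.uncurry]
      rw [this]
      exact (hS.comp measurable_fst).indicator (measurableSet_le measurable_fst measurable_snd)

/-- The differential of the reciprocal of the survival function: `d(1/F) = -dF / (F F_-)`. -/
theorem one_add_lintegral_inv_mul_inv (ν : Measure α) [IsProbabilityMeasure ν] {L : Set α}
    (hL : MeasurableSet L) (hlow : IsLowerSet L) :
    1 + ∫⁻ s in L, (ν (Ioi s))⁻¹ * (ν (Ici s))⁻¹ ∂ν = (ν Lᶜ)⁻¹ := by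
  have h1 : ∀ s, (ν (Ioi s))⁻¹ * (ν (Ici s))⁻¹ = ∑' k, cdfPowSum ν k s := fun s => by
    rw [tsum_cdfPowSum, ← prob_compl_eq_one_sub measurableSet_Iic,
      ← prob_compl_eq_one_sub measurableSet_Iio, compl_Iic, compl_Iio]
  simp_rw [h1]
  rw [lintegral_tsum fun k => (measurable_cdfPowSum ν k).aemeasurable,
    prob_compl_eq_one_sub hL, ← ENNReal.tsum_geometric,
    (tsum_eq_zero_add' ENNReal.summable : ∑' k, ν L ^ k = _), pow_zero]
  simp_rw [measure_pow_succ_eq_lintegral ν _ hL hlow]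

/-- This is an upper set. If it has a least element `c`, it lies in the null set `Ici c`; otherwise
it is a union of null rays `Ioi s`, of which countably many suffice by second countability. -/
theorem measure_setOf_measure_Ici_eq_zero (ν : Measure α) :
    ν {s | ν (Ici s) = 0} = 0 := by
  by_cases hmin : ∃ c, ν (Ici c) = 0 ∧ ∀ s, ν (Ici s) = 0 → c ≤ s
  · obtain ⟨c, hc, hle⟩ := hmin
    exact measure_mono_null hle hc
  · push Not at hmin
    obtain ⟨D, hD, hDc, hU⟩ := TopologicalSpace.isOpen_biUnion_countable
      {s | ν (Ici s) = 0} Ioi fun _ _ => isOpen_Ioi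
    refine measure_mono_null (t := ⋃ s ∈ D, Ioi s) ?_ ((measure_biUnion_null_iff hDc).2
      fun s hs => measure_mono_null Ioi_subset_Ici_self (hD hs))
    rw [hU]
    intro s hs
    obtain ⟨c, hc, hcs⟩ := hmin s hs
    exact mem_biUnion (x := c) hc hcs

variable {E : Type*} [MeasurableSpace E]

/-- The conditional mean `F_s⁻¹ ∫_{]s,∞] × E} h dμ` of `h` after `s`. -/
noncomputable def condTail (μ : Measure (α × E)) (h : α × E → ℝ≥0∞) (s : α) : ℝ≥0∞ :=
  (μ (Ioi s ×ˢ univ))⁻¹ * ∫⁻ z in Ioi s ×ˢ univ, h z ∂μ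

/-- Informally, `∫_{s ≤ r} (h - condTail h) / F_- dμ = ∫ h dμ - condTail h r`, written additively
because `ℝ≥0∞` has no true subtraction. Fubini turns the double integral into `∫ h y * ∫_{s ≤ r, s <
y} 1/(F F_-)`. Adding `h` and integrating `d(1/F)` leaves `h / F_{y-}` for `y ≤ r` and `h / F_r` for
`y > r`. -/
theorem lintegral_add_lintegral_condTail (μ : Measure (α × E)) [IsProbabilityMeasure μ]
    {h : α × E → ℝ≥0∞} (hh : Measurable h) (r : α) :
    ∫⁻ z, h z ∂μ + ∫⁻ z in Iic r ×ˢ univ, (μ (Ici z.1 ×ˢ univ))⁻¹ * condTail μ h z.1 ∂μ =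
      ∫⁻ z in Iic r ×ˢ univ, (μ (Ici z.1 ×ˢ univ))⁻¹ * h z ∂μ + condTail μ h r := by
  have hν : ∀ A : Set α, MeasurableSet A → μ (A ×ˢ (univ : Set E)) = μ.fst A := fun A hA => by
    rw [Measure.fst_apply hA, prod_univ]
  set ν := μ.fst with hνdef
  have hIoi : ∀ s, μ (Ioi s ×ˢ (univ : Set E)) = ν (Ioi s) := fun s => hν _ measurableSet_Ioi
  have hIci : ∀ s, μ (Ici s ×ˢ (univ : Set E)) = ν (Ici s) := fun s => hν _ measurableSet_Ici
  simp only [condTail, hIoi, hIci]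
  set w : α → ℝ≥0∞ := fun s => (ν (Ioi s))⁻¹ * (ν (Ici s))⁻¹ with hw
  have hwm : Measurable w := (measurable_measure_Ioi ν).inv.mul (measurable_measure_Ici ν).inv
  have h1 : ∫⁻ z in Iic r ×ˢ univ, (ν (Ici z.1))⁻¹ *
        ((ν (Ioi z.1))⁻¹ * ∫⁻ y in Ioi z.1 ×ˢ univ, h y ∂μ) ∂μ
      = ∫⁻ y, h y * ∫⁻ s in Iic r ∩ Iio y.1, w s ∂ν ∂μ := by
    have e1 : ∀ z : α × E, (ν (Ici z.1))⁻¹ *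
        ((ν (Ioi z.1))⁻¹ * ∫⁻ y in Ioi z.1 ×ˢ univ, h y ∂μ)
        = ∫⁻ y, {p : (α × E) × (α × E) | p.1.1 < p.2.1}.indicator
          (fun p => h p.2 * w p.1.1) (z, y) ∂μ := by
      intro z
      rw [← mul_assoc, mul_comm (ν (Ici z.1))⁻¹, ← lintegral_const_mul _ hh,
        ← lintegral_indicator (measurableSet_Ioi.prod MeasurableSet.univ)]
      refine lintegral_congr fun y => ?_
      simp [indicator, hw, mul_comm]
    simp_rw [e1]
    rw [lintegral_lintegral_swap]
    · refine lintegral_congr fun y => ?_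
      rw [← lintegral_const_mul _ hwm, ← lintegral_indicator (measurableSet_Iic.inter measurableSet_Iio),
        hνdef, Measure.fst, lintegral_map _ measurable_fst,
        ← lintegral_indicator (measurableSet_Iic.prod MeasurableSet.univ)]
      · refine lintegral_congr fun z => ?_
        by_cases h1 : z.1 ≤ r <;> by_cases h2 : z.1 < y.1 <;> simp [indicator, h1, h2]
      · exact (hwm.const_mul _).indicator (measurableSet_Iic.inter measurableSet_Iio)
    · refine Measurable.aemeasurable ?_
      exact Measurable.indicator ((hh.comp measurable_snd).mul
        (hwm.comp (measurable_fst.comp measurable_fst)))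
        (measurableSet_lt (measurable_fst.comp measurable_fst)
          (measurable_fst.comp measurable_snd))
  have h2 : ∀ y : α × E, h y + h y * ∫⁻ s in Iic r ∩ Iio y.1, w s ∂ν
      = (Iic r ×ˢ univ).indicator (fun z => (ν (Ici z.1))⁻¹ * h z) y +
        (Ioi r ×ˢ univ).indicator (fun z => (ν (Ioi r))⁻¹ * h z) y := by
    intro y
    have := one_add_lintegral_inv_mul_inv ν (L := Iic r ∩ Iio y.1)
      (measurableSet_Iic.inter measurableSet_Iio) ((isLowerSet_Iic r).inter (isLowerSet_Iio y.1))
    have h3 : h y + h y * ∫⁻ s in Iic r ∩ Iio y.1, w s ∂ν = h y * (ν (Iic r ∩ Iio y.1)ᶜ)⁻¹ := by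
      rw [← this, mul_add, mul_one]
    rw [h3]
    rcases le_or_gt y.1 r with hy | hy
    · have : Iic r ∩ Iio y.1 = Iio y.1 := inter_eq_right.2 fun s hs => hs.le.trans hy
      simp [this, indicator, hy, not_lt.2 hy, mul_comm]
    · have : Iic r ∩ Iio y.1 = Iic r := inter_eq_left.2 fun s hs => lt_of_le_of_lt hs hy
      simp [this, indicator, hy, not_le.2 hy, mul_comm]
  rw [h1, ← lintegral_add_left hh, lintegral_congr h2, lintegral_add_left,
    lintegral_indicator (measurableSet_Iic.prod MeasurableSet.univ),
    lintegral_indicator (measurableSet_Ioi.prod MeasurableSet.univ), lintegral_const_mul _ hh]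
  exact (((measurable_measure_Ici ν).comp measurable_fst).inv.mul hh).indicator
    (measurableSet_Iic.prod MeasurableSet.univ)

end LinearOrder

/-! ### Disintegration along a conditional law. -/

section Disintegration

open ProbabilityTheory

variable {α β Ω : Type*} [mα : MeasurableSpace α] [mβ : MeasurableSpace β]

theorem lintegral_comp_prodMk_eq_of_kernel [MeasurableSpace Ω] {P : Measure Ω} [IsFiniteMeasure P]
    {π : Ω → α} (hπ : Measurable π) {W : Ω → β} (hW : Measurable W) (κ : Kernel α β)
    [IsMarkovKernel κ]
    (h : ∀ A, MeasurableSet A → ∀ B, MeasurableSet B →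
      ∫⁻ ω in π ⁻¹' A, κ (π ω) B ∂P = P (π ⁻¹' A ∩ W ⁻¹' B))
    {φ : α × β → ℝ≥0∞} (hφ : Measurable φ) :
    ∫⁻ ω, φ (π ω, W ω) ∂P = ∫⁻ ω, ∫⁻ z, φ (π ω, z) ∂κ (π ω) ∂P := by
  have key : (P.map π) ⊗ₘ κ = P.map fun ω => (π ω, W ω) := by
    refine Measure.ext_prod fun {A B} hA hB => ?_
    rw [Measure.compProd_apply_prod hA hB, setLIntegral_map hA (κ.measurable_coe hB) hπ, h A hA B hB,
      Measure.map_apply (hπ.prodMk hW) (hA.prod hB)]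
    rfl
  rw [← lintegral_map hφ (hπ.prodMk hW), ← key, Measure.lintegral_compProd hφ,
    lintegral_map hφ.lintegral_kernel_prod_right' hπ]

/-- Conditioning on `m` is conditioning on the identity map from `(Ω, mΩ)` to `(Ω, m)`, so the
version for kernels applies. -/
theorem lintegral_comp_prodMk_eq {m mΩ : MeasurableSpace Ω} (hm : m ≤ mΩ) {P : Measure Ω}
    [IsFiniteMeasure P] {W : Ω → β} (hW : Measurable W) {κ : Ω → Measure β}
    (hprob : ∀ ω, IsProbabilityMeasure (κ ω))
    (hmeas : ∀ B, MeasurableSet B → Measurable[m] fun ω => κ ω B)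
    (h : ∀ A, MeasurableSet[m] A → ∀ B, MeasurableSet B →
      ∫⁻ ω in A, κ ω B ∂P = P (A ∩ W ⁻¹' B))
    {φ : Ω × β → ℝ≥0∞} (hφ : Measurable[m.prod mβ] φ) :
    ∫⁻ ω, φ (ω, W ω) ∂P = ∫⁻ ω, ∫⁻ z, φ (ω, z) ∂κ ω ∂P :=
  let κ' : @Kernel Ω β m mβ := @Kernel.mk Ω β m mβ κ
    (@Measure.measurable_of_measurable_coe _ _ mβ m κ hmeas)
  have : @IsMarkovKernel Ω β m mβ κ' := @IsMarkovKernel.mk Ω β m mβ κ' hprob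
  @lintegral_comp_prodMk_eq_of_kernel Ω β Ω m mβ mΩ P _ id (measurable_id'' hm) W hW κ' this h φ hφ

theorem measurable_lintegral_of_measurable_measure {κ : α → Measure β}
    (hprob : ∀ ω, IsProbabilityMeasure (κ ω))
    (hmeas : ∀ B, MeasurableSet B → Measurable fun ω => κ ω B)
    {φ : α × β → ℝ≥0∞} (hφ : Measurable φ) :
    Measurable fun a => ∫⁻ z, φ (a, z) ∂κ a :=
  let κ' : Kernel α β := ⟨κ, Measure.measurable_of_measurable_coe κ hmeas⟩
  have : IsMarkovKernel κ' := ⟨hprob⟩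
  hφ.lintegral_kernel_prod_right' (κ := κ')

variable {τ : Type*} [LinearOrder τ] [TopologicalSpace τ] [OrderTopology τ]
  [SecondCountableTopology τ] [MeasurableSpace τ] [BorelSpace τ]

theorem measurable_condTail {κ : α → Measure (τ × β)}
    (hprob : ∀ ω, IsProbabilityMeasure (κ ω))
    (hmeas : ∀ B, MeasurableSet B → Measurable fun ω => κ ω B)
    {h : α × (τ × β) → ℝ≥0∞} (hh : Measurable h) :
    Measurable fun p : α × τ => condTail (κ p.1) (fun z => h (p.1, z)) p.2 := by
  have hset : MeasurableSet {q : (α × τ) × (τ × β) | q.1.2 < q.2.1} :=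
    measurableSet_lt (measurable_snd.comp measurable_fst) (measurable_fst.comp measurable_snd)
  have key : ∀ f : α × (τ × β) → ℝ≥0∞, Measurable f →
      Measurable fun p : α × τ => ∫⁻ z in Ioi p.2 ×ˢ univ, f (p.1, z) ∂κ p.1 := by
    intro f hf
    have := measurable_lintegral_of_measurable_measure (α := α × τ) (κ := fun p => κ p.1)
      (fun p => hprob p.1) (fun B hB => (hmeas B hB).comp measurable_fst)
      (φ := {q : (α × τ) × (τ × β) | q.1.2 < q.2.1}.indicator fun q => f (q.1.1, q.2))
      ((hf.comp ((measurable_fst.comp measurable_fst).prodMk measurable_snd)).indicator hset)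
    convert this using 2 with p
    rw [← lintegral_indicator (measurableSet_Ioi.prod MeasurableSet.univ)]
    refine lintegral_congr fun z => ?_
    simp [indicator]
  have h1 := key (fun _ => 1) measurable_const
  simp only [setLIntegral_one] at h1
  exact h1.inv.mul (key h hh)

end Disintegration

/-! ### The σ-algebras of the first jumps, of `F_t` and of `F_{T n}`. -/

theorem NNReal.exists_countable_btwn : ∃ D : Set ℝ≥0, D.Countable ∧
    ∀ {a b : ℝ≥0∞}, a < b → ∃ r ∈ D, a < (r : ℝ≥0) ∧ (r : ℝ≥0) < b := by
  obtain ⟨D, hDc, hD⟩ := TopologicalSpace.exists_countable_dense ℝ≥0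
  refine ⟨D, hDc, fun {a b} hab => ?_⟩
  obtain ⟨u, hu1, hu2⟩ := ENNReal.lt_iff_exists_nnreal_btwn.1 hab
  obtain ⟨v, hv1, hv2⟩ := ENNReal.lt_iff_exists_nnreal_btwn.1 hu2
  obtain ⟨r, hr, hr'⟩ := hD.exists_between (ENNReal.coe_lt_coe.1 hv1)
  exact ⟨r, hr, hu1.trans (ENNReal.coe_lt_coe.2 hr'.1), (ENNReal.coe_lt_coe.2 hr'.2).trans hv2⟩

namespace MarkedPointProcess

variable {Ω E : Type*} [mΩ : MeasurableSpace Ω] [mE : MeasurableSpace E] {P : Measure Ω}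

open scoped Classical in
/-- The map on `[0,∞] × E` that forgets the location of a jump that does not occur. -/
noncomputable def forget (x : E) (z : ℝ≥0∞ × E) : ℝ≥0∞ × E :=
  if z.1 = ∞ then (∞, x) else z

theorem measurable_forget (x : E) : Measurable (forget x) :=
  Measurable.ite (measurable_fst (measurableSet_singleton ∞)) measurable_const measurable_id

/-- The pair `(T n, ξ n)`, without the location if `T n = ∞`. -/
noncomputable def mark (X : MarkedPointProcess P E) (n : ℕ) (ω : Ω) : ℝ≥0∞ × E :=
  forget X.x₀ (X.T n ω, X.ξ n ω)

theorem mark_fst (X : MarkedPointProcess P E) (n : ℕ) (ω : Ω) : (X.mark n ω).1 = X.T n ω := by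
  rw [mark, forget]
  split_ifs with h
  · exact h.symm
  · rfl

theorem mark_of_ne_top (X : MarkedPointProcess P E) {n : ℕ} {ω : Ω} (h : X.T n ω ≠ ∞) :
    X.mark n ω = (X.T n ω, X.ξ n ω) := by
  rw [mark, forget, if_neg h]

/-- The σ-algebra generated by the first `n` jumps and the null sets. -/
@[reducible]
noncomputable def markSigma (X : MarkedPointProcess P E) : ℕ → MeasurableSpace Ω
  | 0 => MeasurableSpace.generateFrom {N | MeasurableSet N ∧ P N = 0}
  | n + 1 => ((X.markSigma n).prod inferInstance).comap fun ω => (ω, X.mark (n + 1) ω)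

theorem markSigma_le_succ (X : MarkedPointProcess P E) (n : ℕ) :
    X.markSigma n ≤ X.markSigma (n + 1) := fun A hA =>
  ⟨Prod.fst ⁻¹' A, (@measurable_fst Ω (ℝ≥0∞ × E) (X.markSigma n) _) hA, rfl⟩

theorem markSigma_mono (X : MarkedPointProcess P E) : Monotone X.markSigma :=
  monotone_nat_of_le_succ X.markSigma_le_succ

theorem measurable_mark_markSigma (X : MarkedPointProcess P E) (n : ℕ) :
    Measurable[X.markSigma n] (X.mark n) := by
  cases n with
  | zero =>
    have : X.mark 0 = fun _ => (0, X.x₀) := by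
      ext1 ω
      rw [mark_of_ne_top _ (by simp [X.T_zero]), X.T_zero, X.ξ_zero]
    rw [this]
    exact measurable_const
  | succ n =>
    intro B hB
    exact ⟨Prod.snd ⁻¹' B, (@measurable_snd Ω (ℝ≥0∞ × E) (X.markSigma n) _) hB, rfl⟩

theorem measurable_T_markSigma (X : MarkedPointProcess P E) (n : ℕ) :
    Measurable[X.markSigma n] (X.T n) := by
  have h := (@measurable_fst ℝ≥0∞ E _ _).comp (X.measurable_mark_markSigma n)
  have e : Prod.fst ∘ X.mark n = X.T n := funext fun ω => X.mark_fst n ω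
  rwa [e] at h

open scoped Classical in
/-- The location at time `s` of the process stopped after `n` jumps. -/
noncomputable def stoppedPath (X : MarkedPointProcess P E) (s : ℝ≥0) : ℕ → Ω → E
  | 0 => fun _ => X.x₀
  | n + 1 => fun ω => if X.T (n + 1) ω ≤ s then (X.mark (n + 1) ω).2 else X.stoppedPath s n ω

theorem measurable_stoppedPath (X : MarkedPointProcess P E) (s : ℝ≥0) (n : ℕ) :
    Measurable[X.markSigma n] (X.stoppedPath s n) := by
  induction n with
  | zero => exact measurable_const
  | succ n ih =>
    refine Measurable.ite ?_ ?_ (ih.mono (X.markSigma_le_succ n) le_rfl)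
    · exact X.measurable_T_markSigma (n + 1) measurableSet_Iic
    · exact measurable_snd.comp (X.measurable_mark_markSigma (n + 1))

theorem stoppedPath_eq (X : MarkedPointProcess P E) {s : ℝ≥0} {n k : ℕ} {ω : Ω} (hkn : k ≤ n)
    (h : X.T k ω ≤ s) (h' : s < X.T (k + 1) ω) : X.stoppedPath s n ω = X.ξ k ω := by
  induction n with
  | zero =>
    obtain rfl : k = 0 := by omega
    exact (X.ξ_zero ω).symm
  | succ n ih =>
    simp only [stoppedPath]
    rcases hkn.eq_or_lt with rfl | hlt
    · rw [if_pos h, mark_of_ne_top _ (ne_top_of_le_ne_top ENNReal.coe_ne_top h)]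
    · rw [if_neg (not_le.2 (h'.trans_le (X.T_mono ω hlt))), ih (Nat.lt_succ_iff.1 hlt)]

theorem path_eq_stoppedPath (X : MarkedPointProcess P E) {s t : ℝ≥0} {n : ℕ} {ω : Ω} (hst : s ≤ t)
    (h' : t < X.T (n + 1) ω) : X.path s ω = X.stoppedPath s n ω := by
  have hs : (s : ℝ≥0∞) < X.T (n + 1) ω := (ENNReal.coe_le_coe.2 hst).trans_lt h'
  rcases X.exists_le_lt_or s ω with ⟨k, h1, h2⟩ | h1
  · have hk : k ≤ n := by
      by_contra! h
      exact absurd (hs.trans_le ((X.T_mono ω h).trans h1)) (lt_irrefl _)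
    rw [X.stoppedPath_eq hk h1 h2, path, X.numJumps_eq h1 h2]
  · exact absurd (hs.trans_le (h1 (n + 1))) (lt_irrefl _)

/-- Between two jumps, the events up to time `t` are determined by the past jumps. -/
theorem exists_markSigma_iff (X : MarkedPointProcess P E) {t : ℝ≥0} (n : ℕ) {A : Set Ω}
    (hA : MeasurableSet[X.filtration t] A) :
    ∃ B, MeasurableSet[X.markSigma n] B ∧ ∀ ω, t < X.T (n + 1) ω → (ω ∈ A ↔ ω ∈ B) := by
  let D := {ω // t < X.T (n + 1) ω}
  let v : D → Ω := Subtype.val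
  -- The sets that agree on `{t < T (n + 1)}` with some set of `markSigma n` form a σ-algebra, so it
  -- is enough to treat the generators of `F_t`; there `path` equals `stoppedPath`.
  have hle : X.filtration t ≤ ((X.markSigma n).comap v).map v := by
    refine sup_le (iSup₂_le fun s hs => ?_) ?_
    · rw [← measurable_iff_comap_le]
      intro B hB
      refine ⟨X.stoppedPath s n ⁻¹' B, X.measurable_stoppedPath s n hB, ?_⟩
      ext ⟨ω, hω⟩
      simp [v, X.path_eq_stoppedPath hs hω]
    · exact le_trans (X.markSigma_mono (Nat.zero_le n) : X.markSigma 0 ≤ _)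
        (MeasurableSpace.le_map_comap)
  obtain ⟨B, hB, hBA⟩ := hle A hA
  refine ⟨B, hB, fun ω hω => ?_⟩
  have : (⟨ω, hω⟩ : D) ∈ v ⁻¹' B ↔ (⟨ω, hω⟩ : D) ∈ v ⁻¹' A := by rw [hBA]
  exact this.symm

variable [BlackwellSpace E]

theorem measurableSet_jumpSigma_of_forall (X : MarkedPointProcess P E) {n : ℕ} {A : Set Ω}
    (hA : MeasurableSet[⨆ t, X.filtration t] A)
    (h : ∀ t : ℝ≥0, MeasurableSet[X.filtration t] (A ∩ {ω | X.T n ω ≤ t})) :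
    MeasurableSet[X.jumpSigma n] A := ⟨hA, h⟩

theorem measurableSet_inter_T_le (X : MarkedPointProcess P E) {n : ℕ} {A : Set Ω}
    (hA : MeasurableSet[X.jumpSigma n] A) (t : ℝ≥0) :
    MeasurableSet[X.filtration t] (A ∩ {ω | X.T n ω ≤ t}) := hA.2 t

theorem measurable_T_jumpSigma (X : MarkedPointProcess P E) (n : ℕ) :
    Measurable[X.jumpSigma n] (X.T n) := (X.isStoppingTime_T n).measurable

theorem jumpSigma_le (X : MarkedPointProcess P E) (n : ℕ) : X.jumpSigma n ≤ mΩ :=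
  (X.isStoppingTime_T n).measurableSpace_le

theorem jumpSigma_le_succ (X : MarkedPointProcess P E) (n : ℕ) :
    X.jumpSigma n ≤ X.jumpSigma (n + 1) :=
  IsStoppingTime.measurableSpace_mono _ _ fun ω => X.T_mono ω n.le_succ

/-- The location `ξ n` is read off from the process at any `r` in `[T n, T (n + 1)[`. Rational `r ≤
t` suffice, together with `r = t`, which is needed when `T n = t`. -/
theorem measurableSet_ξ_inter_T_le (X : MarkedPointProcess P E) (n : ℕ) (t : ℝ≥0) {B : Set E}
    (hB : MeasurableSet B) :
    MeasurableSet[X.filtration t] (X.ξ n ⁻¹' B ∩ {ω | X.T n ω ≤ t}) := by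
  let D : Set ℝ≥0 := {r | r ≤ t ∧ (r = t ∨ ∃ q : ℚ, (r : ℝ) = q)}
  have hD : D.Countable := by
    have h1 : (NNReal.toReal ⁻¹' range ((↑) : ℚ → ℝ)).Countable :=
      (countable_range _).preimage_of_injOn NNReal.coe_injective.injOn
    refine (h1.union (countable_singleton t)).mono ?_
    rintro r ⟨-, rfl | ⟨q, hq⟩⟩
    · exact Or.inr rfl
    · exact Or.inl ⟨q, hq.symm⟩
  have hpt : ∀ ω, X.T n ω ≤ t → ∃ r ∈ D, X.T n ω ≤ r ∧ r < X.T (n + 1) ω := by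
    intro ω hk
    rcases lt_or_ge (t : ℝ≥0∞) (X.T (n + 1) ω) with h | h
    · exact ⟨t, ⟨le_rfl, Or.inl rfl⟩, hk, h⟩
    · obtain ⟨q, hq0, h1, h2⟩ :=
        ENNReal.lt_iff_exists_rat_btwn.1 (X.T_lt n ω (ne_top_of_le_ne_top ENNReal.coe_ne_top hk))
      refine ⟨Real.toNNReal q, ⟨?_, Or.inr ⟨q, ?_⟩⟩, h1.le, h2⟩
      · exact_mod_cast (h2.trans_le h).le
      · exact Real.coe_toNNReal _ (by exact_mod_cast hq0)
  have e : X.ξ n ⁻¹' B ∩ {ω | X.T n ω ≤ t} =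
      ⋃ r ∈ D, X.path r ⁻¹' B ∩ ({ω | X.T n ω ≤ r} ∩ {ω | X.T (n + 1) ω ≤ r}ᶜ) := by
    ext ω
    simp only [mem_inter_iff, mem_preimage, mem_ofPred_eq, mem_iUnion, mem_compl_iff, not_le,
      exists_prop]
    constructor
    · rintro ⟨h1, h2⟩
      obtain ⟨r, hr, hr1, hr2⟩ := hpt ω h2
      exact ⟨r, hr, by rwa [path, X.numJumps_eq hr1 hr2], hr1, hr2⟩
    · rintro ⟨r, hr, h1, hr1, hr2⟩
      rw [path, X.numJumps_eq hr1 hr2] at h1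
      exact ⟨h1, hr1.trans (ENNReal.coe_le_coe.2 hr.1)⟩
  rw [e]
  refine MeasurableSet.biUnion hD fun r hr => ?_
  refine (X.measurable_path_filtration hr.1 hB).inter (X.filtration.mono hr.1 _ ?_)
  exact (X.isStoppingTime_T n r).inter (X.isStoppingTime_T (n + 1) r).compl

/-- Here `forget` matters: where `T n = ∞`, the process carries no trace of `ξ n`, and the mark is
constant there. -/
theorem measurable_mark_jumpSigma (X : MarkedPointProcess P E) (n : ℕ) :
    Measurable[X.jumpSigma n] (X.mark n) := by
  have hT := X.measurable_T_jumpSigma n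
  suffices h : Measurable[X.jumpSigma n] fun ω => (X.mark n ω).2 by
    have h1 : Measurable[X.jumpSigma n] fun ω => (X.mark n ω).1 := by simpa only [mark_fst] using hT
    exact (show X.mark n = fun ω => ((X.mark n ω).1, (X.mark n ω).2) from rfl) ▸ h1.prodMk h
  intro B hB
  have hfin : ∀ t : ℝ≥0, MeasurableSet[X.filtration t] (X.ξ n ⁻¹' B ∩ {ω | X.T n ω ≤ t}) :=
    fun t => X.measurableSet_ξ_inter_T_le n t hB
  have e : (fun ω => (X.mark n ω).2) ⁻¹' B =
      (X.T n ⁻¹' {∞} ∩ {_ω | X.x₀ ∈ B}) ∪ ⋃ k : ℕ, X.ξ n ⁻¹' B ∩ {ω | X.T n ω ≤ (k : ℝ≥0)} := by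
    ext ω
    simp only [mem_preimage, mem_union, mem_inter_iff, mem_iUnion, mem_singleton_iff,
      mem_ofPred_eq]
    by_cases h : X.T n ω = ∞
    · simp [mark, forget, h]
    · rw [X.mark_of_ne_top h]
      obtain ⟨k, hk⟩ := ENNReal.exists_nat_gt h
      simp only [h, false_and, false_or]
      exact ⟨fun h' => ⟨k, h', by simpa using hk.le⟩, fun ⟨_, h', _⟩ => h'⟩
  rw [e]
  refine MeasurableSet.union ?_ (MeasurableSet.iUnion fun k => ?_)
  · exact (hT (measurableSet_singleton ∞)).inter (MeasurableSet.const _)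
  · refine X.measurableSet_jumpSigma_of_forall
      (le_iSup (fun t : ℝ≥0 => (X.filtration t : MeasurableSpace Ω)) (k : ℝ≥0) _ (hfin k))
      fun t => ?_
    have : X.ξ n ⁻¹' B ∩ {ω | X.T n ω ≤ ((k : ℝ≥0) : ℝ≥0∞)} ∩ {ω | X.T n ω ≤ t} =
        X.ξ n ⁻¹' B ∩ {ω | X.T n ω ≤ ((min (k : ℝ≥0) t : ℝ≥0) : ℝ≥0∞)} := by
      ext ω
      simp [and_assoc]
    rw [this]
    exact X.filtration.mono (min_le_right _ _) _ (hfin _)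

theorem markSigma_le_jumpSigma (X : MarkedPointProcess P E) (n : ℕ) :
    X.markSigma n ≤ X.jumpSigma n := by
  induction n with
  | zero =>
    refine MeasurableSpace.generateFrom_le fun N hN => ?_
    refine X.measurableSet_jumpSigma_of_forall
      (le_iSup (fun t : ℝ≥0 => (X.filtration t : MeasurableSpace Ω)) 0 _
        (X.measurableSet_filtration_of_null hN.1 hN.2)) fun t => ?_
    exact (X.measurableSet_filtration_of_null hN.1 hN.2).inter (X.isStoppingTime_T 0 t)
  | succ n ih =>
    rw [markSigma, ← measurable_iff_comap_le]
    exact Measurable.prodMk (measurable_id'' (ih.trans (X.jumpSigma_le_succ n)))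
      (X.measurable_mark_jumpSigma (n + 1))

theorem markSigma_le (X : MarkedPointProcess P E) (n : ℕ) : X.markSigma n ≤ mΩ :=
  (X.markSigma_le_jumpSigma n).trans (X.jumpSigma_le n)

/-- On `{T n < ∞}`, the events up to the `n`-th jump are determined by the first `n` jumps. -/
theorem measurableSet_markSigma_inter (X : MarkedPointProcess P E) {n : ℕ} {A : Set Ω}
    (hA : MeasurableSet[X.jumpSigma n] A) :
    MeasurableSet[X.markSigma n] (A ∩ {ω | X.T n ω ≠ ∞}) := by
  obtain ⟨D, hDc, hbtw⟩ := NNReal.exists_countable_btwn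
  choose B hB hBA using fun t : ℝ≥0 =>
    X.exists_markSigma_iff n (X.measurableSet_inter_T_le hA t)
  -- `B r` represents `A ∩ {T n ≤ r}` only where `r < T (n + 1)`, so `r` must be chosen close to `T
  -- n` from above. Testing below every `q > T n` achieves this, since some such `q` lies below `T
  -- (n + 1)`.
  have e : A ∩ {ω | X.T n ω ≠ ∞} = {ω | X.T n ω ≠ ∞} ∩ ⋂ q ∈ D, ({ω | X.T n ω < q}ᶜ ∪
      ⋃ r ∈ D ∩ Iio q, ({ω | X.T n ω < r} ∩ B r)) := by
    ext ω
    simp only [mem_inter_iff, mem_ofPred_eq, mem_iInter, mem_union, mem_compl_iff, mem_iUnion,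
      not_lt, mem_Iio, exists_prop]
    constructor
    · rintro ⟨hωA, hfin⟩
      refine ⟨hfin, fun q hq => ?_⟩
      rcases le_or_gt (q : ℝ≥0∞) (X.T n ω) with h | h
      · exact Or.inl h
      · obtain ⟨r, hr, hr1, hr2⟩ := hbtw (lt_min h (X.T_lt n ω hfin))
        refine Or.inr ⟨r, ⟨hr, ENNReal.coe_lt_coe.1 (hr2.trans_le (min_le_left _ _))⟩, hr1, ?_⟩
        exact (hBA r ω (hr2.trans_le (min_le_right _ _))).1 ⟨hωA, hr1.le⟩
    · rintro ⟨hfin, h⟩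
      refine ⟨?_, hfin⟩
      obtain ⟨q, hq, hq1, hq2⟩ := hbtw (X.T_lt n ω hfin)
      rcases h q hq with h' | ⟨r, ⟨-, hrq⟩, hr1, hrB⟩
      · exact absurd (hq1.trans_le h') (lt_irrefl _)
      · exact ((hBA r ω ((ENNReal.coe_lt_coe.2 hrq).trans hq2)).2 hrB).1
  have hT := X.measurable_T_markSigma n
  rw [e]
  refine (hT (measurableSet_singleton ∞).compl).inter (MeasurableSet.biInter hDc fun q _ => ?_)
  refine (hT measurableSet_Iio).compl.union
    (MeasurableSet.biUnion (hDc.mono inter_subset_left) fun r _ => ?_)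
  exact (hT measurableSet_Iio).inter (hB r)

end MarkedPointProcess

/-! ### Integrals against a conditional law given a sub-σ-algebra. -/

theorem measurable_lintegral_sub {Ω β : Type*} {m : MeasurableSpace Ω} [mβ : MeasurableSpace β]
    {κ : Ω → Measure β} (hprob : ∀ ω, IsProbabilityMeasure (κ ω))
    (hmeas : ∀ B, MeasurableSet B → Measurable[m] fun ω => κ ω B)
    {φ : Ω × β → ℝ≥0∞} (hφ : Measurable[m.prod mβ] φ) :
    Measurable[m] fun ω => ∫⁻ z, φ (ω, z) ∂κ ω :=
  measurable_lintegral_of_measurable_measure hprob hmeas hφ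

/-- Passes from identities in `ℝ≥0∞` for positive and negative parts to the real integral;
finiteness comes from `u`. -/
theorem integral_toReal_sub_toReal {Ω : Type*} [MeasurableSpace Ω] {Q : Measure Ω} {u : Ω → ℝ}
    (hu : Integrable u Q) {up um : Ω → ℝ≥0∞} (hup : AEMeasurable up Q) (hum : AEMeasurable um Q)
    (hp : ∫⁻ ω, up ω ∂Q = ∫⁻ ω, ENNReal.ofReal (u ω) ∂Q)
    (hn : ∫⁻ ω, um ω ∂Q = ∫⁻ ω, ENNReal.ofReal (-u ω) ∂Q) :
    Integrable (fun ω => (up ω).toReal - (um ω).toReal) Q ∧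
      ∫ ω, ((up ω).toReal - (um ω).toReal) ∂Q = ∫ ω, u ω ∂Q := by
  have hp' : ∫⁻ ω, up ω ∂Q ≠ ∞ := hp ▸ (hu.lintegral_lt_top).ne
  have hn' : ∫⁻ ω, um ω ∂Q ≠ ∞ := hn ▸ (hu.neg.lintegral_lt_top).ne
  have ip := integrable_toReal_of_lintegral_ne_top hup hp'
  have im := integrable_toReal_of_lintegral_ne_top hum hn'
  refine ⟨ip.sub im, ?_⟩
  rw [integral_sub ip im, integral_toReal hup (ae_lt_top' hup hp'),
    integral_toReal hum (ae_lt_top' hum hn'), hp, hn,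
    ← integral_eq_lintegral_pos_part_sub_lintegral_neg_part hu]

section Sub

variable {Ω β τ : Type*} {m mΩ : MeasurableSpace Ω} [mβ : MeasurableSpace β] {P : Measure Ω}
  [IsFiniteMeasure P] [LinearOrder τ] [TopologicalSpace τ] [OrderTopology τ]
  [SecondCountableTopology τ] [mτ : MeasurableSpace τ] [BorelSpace τ]

theorem measure_mul_condTail (μ : Measure (τ × β)) [IsFiniteMeasure μ] (h : τ × β → ℝ≥0∞) (s : τ) :
    μ (Ioi s ×ˢ univ) * condTail μ h s = ∫⁻ z in Ioi s ×ˢ univ, h z ∂μ := by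
  rw [condTail, ← mul_assoc]
  by_cases h0 : μ (Ioi s ×ˢ univ) = 0
  · rw [setLIntegral_measure_zero _ _ h0, mul_zero]
  · rw [ENNReal.mul_inv_cancel h0 (measure_ne_top _ _), one_mul]

theorem measurable_condTail_const {α : Type*} [MeasurableSpace α] {κ : α → Measure (τ × β)}
    (hprob : ∀ ω, IsProbabilityMeasure (κ ω))
    (hmeas : ∀ B, MeasurableSet B → Measurable fun ω => κ ω B)
    {f : α × (τ × β) → ℝ≥0∞} (hf : Measurable f) (t : τ) :
    Measurable fun ω => condTail (κ ω) (fun z => f (ω, z)) t :=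
  Measurable.comp (g := fun p : α × τ => condTail (κ p.1) (fun z => f (p.1, z)) p.2)
    (f := fun ω => (ω, t)) (measurable_condTail hprob hmeas hf)
    (measurable_id.prodMk measurable_const)

theorem measurable_measure_Ici_prod {α : Type*} {_ : MeasurableSpace α} {κ : α → Measure (τ × β)}
    (hprob : ∀ ω, IsProbabilityMeasure (κ ω))
    (hmeas : ∀ B, MeasurableSet B → Measurable fun ω => κ ω B) :
    Measurable fun q : α × (τ × β) => κ q.1 (Ici q.2.1 ×ˢ univ) := by
  have h1 := measurable_lintegral_of_measurable_measure (α := α × (τ × β))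
    (κ := fun p => κ p.1) (fun p => hprob p.1)
    (fun B hB => (hmeas B hB).comp measurable_fst)
    (φ := {q : (α × (τ × β)) × (τ × β) | q.1.2.1 ≤ q.2.1}.indicator fun _ => 1)
    (measurable_const.indicator (measurableSet_le
      (measurable_fst.comp (measurable_snd.comp measurable_fst))
      (measurable_fst.comp measurable_snd)))
  convert h1 using 2 with p
  rw [← lintegral_indicator_one (measurableSet_Ici.prod MeasurableSet.univ)]
  refine lintegral_congr fun z => ?_
  simp [indicator]

theorem measurable_condTail_sub {κ : Ω → Measure (τ × β)}
    (hprob : ∀ ω, IsProbabilityMeasure (κ ω))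
    (hmeas : ∀ B, MeasurableSet B → Measurable[m] fun ω => κ ω B)
    {f : Ω × (τ × β) → ℝ≥0∞} (hf : Measurable[m.prod inferInstance] f) :
    Measurable[m.prod mτ] fun p : Ω × τ => condTail (κ p.1) (fun z => f (p.1, z)) p.2 :=
  measurable_condTail hprob hmeas hf

theorem measurable_condTail_const_sub {κ : Ω → Measure (τ × β)}
    (hprob : ∀ ω, IsProbabilityMeasure (κ ω))
    (hmeas : ∀ B, MeasurableSet B → Measurable[m] fun ω => κ ω B)
    {f : Ω × (τ × β) → ℝ≥0∞} (hf : Measurable[m.prod inferInstance] f) (t : τ) :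
    Measurable[m] fun ω => condTail (κ ω) (fun z => f (ω, z)) t :=
  measurable_condTail_const hprob hmeas hf t

variable (hm : m ≤ mΩ) {W : Ω → τ × β} (hW : Measurable W)
  {κ : Ω → Measure (τ × β)} (hprob : ∀ ω, IsProbabilityMeasure (κ ω))
  (hmeas : ∀ B, MeasurableSet B → Measurable[m] fun ω => κ ω B)
  (h : ∀ A, MeasurableSet[m] A → ∀ B, MeasurableSet B → ∫⁻ ω in A, κ ω B ∂P = P (A ∩ W ⁻¹' B))

include hm hW hprob hmeas h

theorem setLIntegral_comp_prodMk_eq {f : Ω × (τ × β) → ℝ≥0∞}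
    (hf : Measurable[m.prod inferInstance] f) {C : Set Ω} (hC : MeasurableSet[m] C) :
    ∫⁻ ω in C, ∫⁻ z, f (ω, z) ∂κ ω ∂P = ∫⁻ ω in C, f (ω, W ω) ∂P := by
  have h1 := lintegral_comp_prodMk_eq hm hW hprob hmeas h
    (φ := (Prod.fst ⁻¹' C).indicator f)
    (hf.indicator ((@measurable_fst Ω (τ × β) m _) hC))
  rw [← lintegral_indicator (hm _ hC), ← lintegral_indicator (hm _ hC)]
  refine Eq.trans (lintegral_congr fun ω => ?_) (h1.symm.trans (lintegral_congr fun ω => ?_))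
  · by_cases hω : ω ∈ C <;> simp [indicator, hω]
  · by_cases hω : ω ∈ C <;> simp [indicator, hω]

/-- Integrating out `W` under `κ ω` makes both sides the integral over `C` of `∫_{]t,∞]} f dκ`: on
the left the integrand does not depend on `W`, and the survival probability cancels the
normalization of `condTail`. -/
theorem setLIntegral_condTail_eq {f : Ω × (τ × β) → ℝ≥0∞}
    (hf : Measurable[m.prod inferInstance] f) {C : Set Ω} (hC : MeasurableSet[m] C) (t : τ) :
    ∫⁻ ω in C ∩ {ω | t < (W ω).1}, condTail (κ ω) (fun z => f (ω, z)) t ∂P =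
      ∫⁻ ω in C ∩ {ω | t < (W ω).1}, f (ω, W ω) ∂P := by
  have hS : MeasurableSet {z : τ × β | t < z.1} := measurable_fst measurableSet_Ioi
  have hS' : MeasurableSet[m.prod inferInstance] (Prod.snd ⁻¹' {z : τ × β | t < z.1} : Set (Ω × (τ × β))) :=
    (@measurable_snd Ω (τ × β) m _) hS
  have key : ∀ φ : Ω × (τ × β) → ℝ≥0∞, Measurable[m.prod inferInstance] φ →
      ∫⁻ ω in C ∩ {ω | t < (W ω).1}, φ (ω, W ω) ∂P
        = ∫⁻ ω in C, ∫⁻ z in Ioi t ×ˢ univ, φ (ω, z) ∂κ ω ∂P := by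
    intro φ hφ
    have := setLIntegral_comp_prodMk_eq hm hW hprob hmeas h (hφ.indicator hS') hC
    have hS'' : MeasurableSet {ω | t < (W ω).1} := hW hS
    rw [inter_comm, ← Measure.restrict_restrict hS'', ← lintegral_indicator hS'']
    refine Eq.trans (lintegral_congr fun ω => ?_) (this.symm.trans (lintegral_congr fun ω => ?_))
    · simp [indicator]
    · rw [← lintegral_indicator (measurableSet_Ioi.prod MeasurableSet.univ)]
      refine lintegral_congr fun z => ?_
      simp [indicator]
  rw [key _ hf, key (fun p => condTail (κ p.1) (fun z => f (p.1, z)) t)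
    ((measurable_condTail_const_sub hprob hmeas hf t).comp (@measurable_fst Ω (τ × β) m _))]
  refine lintegral_congr fun ω => ?_
  change ∫⁻ z in Ioi t ×ˢ univ, condTail (κ ω) (fun y => f (ω, y)) t ∂κ ω = _
  rw [setLIntegral_const, mul_comm, measure_mul_condTail]

/-- The probability that `W` lands in a set of conditional probability zero is zero. -/
theorem ae_measure_Ici_ne_zero : ∀ᵐ ω ∂P, κ ω (Ici (W ω).1 ×ˢ univ) ≠ 0 := by
  have hset : MeasurableSet[(m.prod inferInstance)]
      {q : Ω × (τ × β) | κ q.1 (Ici q.2.1 ×ˢ univ) = 0} :=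
    measurable_measure_Ici_prod hprob hmeas (measurableSet_singleton 0)
  have h1 := lintegral_comp_prodMk_eq hm hW hprob hmeas h
    (φ := {q : Ω × (τ × β) | κ q.1 (Ici q.2.1 ×ˢ univ) = 0}.indicator fun _ => 1)
    (measurable_const.indicator hset)
  have h2 : ∀ ω, ∫⁻ z, {q : Ω × (τ × β) | κ q.1 (Ici q.2.1 ×ˢ univ) = 0}.indicator
      (fun _ => (1 : ℝ≥0∞)) (ω, z) ∂κ ω = 0 := by
    intro ω
    have hs : MeasurableSet {s | κ ω (Ici s ×ˢ (univ : Set β)) = 0} := by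
      have : Measurable fun s => (κ ω).fst (Ici s) := measurable_measure_Ici _
      simp_rw [Measure.fst_apply measurableSet_Ici, ← prod_univ] at this
      exact this (measurableSet_singleton 0)
    have h3 := measure_setOf_measure_Ici_eq_zero (κ ω).fst
    simp_rw [Measure.fst_apply measurableSet_Ici, ← prod_univ] at h3
    rw [Measure.fst_apply hs] at h3
    refine Eq.trans ?_ ((lintegral_indicator_one (measurable_fst hs)).trans h3)
    rfl
  simp_rw [h2, lintegral_zero] at h1
  have hset' : MeasurableSet {ω | κ ω (Ici (W ω).1 ×ˢ univ) = 0} :=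
    ((measurable_id'' hm).prodMk hW) hset
  refine ae_iff.2 ?_
  simp only [not_not]
  refine Eq.trans (lintegral_indicator_one hset').symm (Eq.trans ?_ h1)
  rfl

/-- By disintegration, the mean of the `κ`-mass of the sections is the probability that `(ω, W ω)`
lies in `S`. -/
theorem ae_measure_section_eq_zero {S : Set (Ω × (τ × β))}
    (hS : MeasurableSet[m.prod inferInstance] S) (h0 : ∀ᵐ ω ∂P, (ω, W ω) ∉ S) :
    ∀ᵐ ω ∂P, κ ω {z | (ω, z) ∈ S} = 0 := by
  have h1 := lintegral_comp_prodMk_eq hm hW hprob hmeas h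
    (φ := S.indicator fun _ => 1) (measurable_const.indicator hS)
  have h2 : ∫⁻ ω, S.indicator (fun _ => (1 : ℝ≥0∞)) (ω, W ω) ∂P = 0 := by
    rw [lintegral_congr_ae (g := fun _ => 0) _, lintegral_zero]
    filter_upwards [h0] with ω hω
    simp [hω]
  rw [h2] at h1
  have h3 := (lintegral_eq_zero_iff ((measurable_lintegral_sub hprob hmeas
    (measurable_const.indicator hS)).mono hm le_rfl)).1 h1.symm
  filter_upwards [h3] with ω hω
  rw [← lintegral_indicator_one]
  · exact hω
  · exact (@measurable_prodMk_left Ω (τ × β) m _ ω) hS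

theorem ae_lintegral_lt_top {f : Ω × (τ × β) → ℝ≥0∞}
    (hf : Measurable[m.prod inferInstance] f) (hfin : ∫⁻ ω, f (ω, W ω) ∂P ≠ ∞) :
    ∀ᵐ ω ∂P, ∫⁻ z, f (ω, z) ∂κ ω < ∞ := by
  rw [lintegral_comp_prodMk_eq hm hW hprob hmeas h hf] at hfin
  exact ae_lt_top ((measurable_lintegral_sub hprob hmeas hf).mono hm le_rfl) hfin

end Sub

/-! ### Conditional expectations given the first jumps and given `F_t`. -/

/-- The conditional mean after `s` of a real function `f` under the law `μ`. -/
noncomputable def condMean {τ E : Type*} [LinearOrder τ] [MeasurableSpace τ] [MeasurableSpace E]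
    (μ : Measure (τ × E)) (f : τ × E → ℝ) (s : τ) : ℝ :=
  (condTail μ (fun z => ENNReal.ofReal (f z)) s).toReal -
    (condTail μ (fun z => ENNReal.ofReal (-f z)) s).toReal

theorem measurable_indicator_of_inter {Ω : Type*} {m m' : MeasurableSpace Ω} {F : Set Ω} {f : Ω → ℝ}
    (hf : Measurable[m] f) (hF : MeasurableSet[m'] F)
    (h : ∀ A, MeasurableSet[m] A → MeasurableSet[m'] (A ∩ F)) : Measurable[m'] (F.indicator f) := by
  classical
  intro B hB
  by_cases h0 : (0 : ℝ) ∈ B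
  · have e : F.indicator f ⁻¹' B = (f ⁻¹' B ∩ F) ∪ Fᶜ := by
      ext ω
      by_cases hω : ω ∈ F <;> simp [hω, h0]
    rw [e]
    exact (h _ (hf hB)).union hF.compl
  · have e : F.indicator f ⁻¹' B = f ⁻¹' B ∩ F := by
      ext ω
      by_cases hω : ω ∈ F <;> simp [hω, h0]
    rw [e]
    exact h _ (hf hB)

namespace MarkedPointProcess

variable {Ω E : Type*} [mΩ : MeasurableSpace Ω] [mE : MeasurableSpace E] {P : Measure Ω}
  [BlackwellSpace E]

/-- `h n (ω, (T (n + 1), ξ (n + 1)))` is a version of the conditional expectation of `Y` given the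
first `n + 1` jumps, where `h n` depends on `ω` through the first `n` jumps only. -/
structure IsJumpVersion (X : MarkedPointProcess P E) (Y : Ω → ℝ)
    (h : ℕ → Ω × (ℝ≥0∞ × E) → ℝ) : Prop where
  measurable : ∀ n, Measurable[(X.jumpSigma n).prod inferInstance] (h n)
  condExp_eq : ∀ n ω,
    (P[Y | X.markSigma (n + 1)]) ω = h n (ω, (X.T (n + 1) ω, X.ξ (n + 1) ω))

theorem exists_isJumpVersion (X : MarkedPointProcess P E) (Y : Ω → ℝ) :
    ∃ h, X.IsJumpVersion Y h := by
  -- Doob-Dynkin: `markSigma (n + 1)` is by construction the pull-back under `ω ↦ (ω, mark (n + 1)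
  -- ω)`, with the first coordinate measured by `markSigma n`.
  have key : ∀ n, ∃ f : Ω × (ℝ≥0∞ × E) → ℝ, Measurable[(X.markSigma n).prod inferInstance] f ∧
      P[Y | X.markSigma (n + 1)] = f ∘ fun ω => (ω, X.mark (n + 1) ω) := by
    intro n
    have hY : Measurable[X.markSigma (n + 1)] (P[Y | X.markSigma (n + 1)]) :=
      stronglyMeasurable_condExp.measurable
    exact Measurable.exists_eq_measurable_comp (mY := (X.markSigma n).prod inferInstance) hY
  choose f hf hfY using key
  -- `κ` is the law of the raw pair `(T, ξ)`, not of the mark, so `forget` is absorbed into `h n`.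
  refine ⟨fun n p => f n (p.1, forget X.x₀ p.2), fun n => ?_, fun n ω => congrFun (hfY n) ω⟩
  refine ((hf n).mono (sup_le_sup (MeasurableSpace.comap_mono (X.markSigma_le_jumpSigma n)) le_rfl)
    le_rfl).comp ?_
  exact (@measurable_fst Ω (ℝ≥0∞ × E) (X.jumpSigma n) _).prodMk
    ((measurable_forget X.x₀).comp (@measurable_snd Ω (ℝ≥0∞ × E) (X.jumpSigma n) _))

theorem measurable_indicator_markSigma (X : MarkedPointProcess P E) {n : ℕ} {f : Ω → ℝ}
    (hf : Measurable[X.jumpSigma n] f) :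
    Measurable[X.markSigma n] ({ω | X.T n ω ≠ ∞}.indicator f) := measurable_indicator_of_inter hf
    (X.measurable_T_markSigma n (measurableSet_singleton ∞).compl)
    fun _ hA => X.measurableSet_markSigma_inter hA

theorem measurable_indicator_filtration (X : MarkedPointProcess P E) {n : ℕ} {f : Ω → ℝ}
    (hf : Measurable[X.jumpSigma n] f) (t : ℝ≥0) :
    Measurable[X.filtration t] ({ω | X.T n ω ≤ t}.indicator f) :=
  measurable_indicator_of_inter hf (X.isStoppingTime_T n t)
    fun _ hA => X.measurableSet_inter_T_le hA t

variable [IsProbabilityMeasure P] {X : MarkedPointProcess P E} {κ : ℕ → Ω → Measure (ℝ≥0∞ × E)}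

theorem measurable_T_ξ (X : MarkedPointProcess P E) (n : ℕ) :
    Measurable fun ω => (X.T n ω, X.ξ n ω) := (X.measurable_T n).prodMk (X.measurable_ξ n)

/-- Finite jump times increase strictly. This confines the compensator of the jump `n + 1` to times
after `T n`. -/
theorem IsRegularJumpLaw.ae_Iic_T_eq_zero {n : ℕ} {κ : Ω → Measure (ℝ≥0∞ × E)}
    (hκ : X.IsRegularJumpLaw n κ) :
    ∀ᵐ ω ∂P, κ ω {z | z.1 ≤ X.T n ω ∧ z.1 ≠ ∞} = 0 := by
  have h1 : Measurable[(X.jumpSigma n).prod inferInstance] fun p : Ω × (ℝ≥0∞ × E) => X.T n p.1 :=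
    (X.measurable_T_jumpSigma n).comp (@measurable_fst Ω (ℝ≥0∞ × E) (X.jumpSigma n) _)
  have h2 : Measurable[(X.jumpSigma n).prod inferInstance] fun p : Ω × (ℝ≥0∞ × E) => p.2.1 :=
    measurable_fst.comp (@measurable_snd Ω (ℝ≥0∞ × E) (X.jumpSigma n) _)
  refine ae_measure_section_eq_zero (X.jumpSigma_le n) (X.measurable_T_ξ (n + 1))
    hκ.isProbabilityMeasure hκ.measurable hκ.setLIntegral
    (S := {p | p.2.1 ≤ X.T n p.1 ∧ p.2.1 ≠ ∞}) ?_ (ae_of_all _ fun ω => ?_)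
  · exact (measurableSet_le h2 h1).inter (h2 (measurableSet_singleton ∞).compl)
  · rintro ⟨h3, h4⟩
    exact absurd (X.T_lt n ω (ne_top_of_le_ne_top h4 (X.T_mono ω n.le_succ))) (not_lt.2 h3)

theorem IsRegularJumpLaw.ae_Ici_T_succ_ne_zero {n : ℕ} {κ : Ω → Measure (ℝ≥0∞ × E)}
    (hκ : X.IsRegularJumpLaw n κ) :
    ∀ᵐ ω ∂P, κ ω (Ici (X.T (n + 1) ω) ×ˢ univ) ≠ 0 :=
  ae_measure_Ici_ne_zero (X.jumpSigma_le n) (X.measurable_T_ξ (n + 1))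
    hκ.isProbabilityMeasure hκ.measurable hκ.setLIntegral

variable {Y : Ω → ℝ} {h : ℕ → Ω × (ℝ≥0∞ × E) → ℝ}

theorem IsJumpVersion.measurable_section (hY : X.IsJumpVersion Y h) (n : ℕ) (ω : Ω) :
    Measurable fun z => h n (ω, z) :=
  (hY.measurable n).comp (@measurable_prodMk_left Ω (ℝ≥0∞ × E) (X.jumpSigma n) _ ω)

theorem IsJumpVersion.integrable_comp (hY : X.IsJumpVersion Y h) (n : ℕ) :
    Integrable (fun ω => h n (ω, (X.T (n + 1) ω, X.ξ (n + 1) ω))) P := by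
  simp_rw [← hY.condExp_eq]
  exact integrable_condExp

theorem IsJumpVersion.setIntegral_comp (hY : X.IsJumpVersion Y h) (hYi : Integrable Y P) (n : ℕ)
    {A : Set Ω} (hA : MeasurableSet[X.markSigma (n + 1)] A) :
    ∫ ω in A, h n (ω, (X.T (n + 1) ω, X.ξ (n + 1) ω)) ∂P = ∫ ω in A, Y ω ∂P := by
  simp_rw [← hY.condExp_eq]
  exact setIntegral_condExp (X.markSigma_le _) hYi hA

theorem IsJumpVersion.ae_integrable (hY : X.IsJumpVersion Y h) (hκ : ∀ n, X.IsRegularJumpLaw n (κ n))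
    (n : ℕ) : ∀ᵐ ω ∂P, Integrable (fun z => h n (ω, z)) (κ n ω) := by
  have hf : Measurable[(X.jumpSigma n).prod inferInstance] fun p => ‖h n p‖ₑ :=
    measurable_enorm.comp (hY.measurable n)
  have := ae_lintegral_lt_top (X.jumpSigma_le n) (X.measurable_T_ξ (n + 1))
    (hκ n).isProbabilityMeasure (hκ n).measurable (hκ n).setLIntegral hf
    (hY.integrable_comp n).2.ne
  filter_upwards [this] with ω hω
  exact ⟨(hY.measurable_section n ω).aestronglyMeasurable, hω⟩

/-- The conditional expectation given the first `n` jumps is the mean under the jump law. -/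
theorem IsJumpVersion.ae_integral_eq (hY : X.IsJumpVersion Y h) (hYi : Integrable Y P)
    (hκ : ∀ n, X.IsRegularJumpLaw n (κ n)) (n : ℕ) :
    ∀ᵐ ω ∂P, X.T n ω ≠ ∞ → ∫ z, h n (ω, z) ∂κ n ω = (P[Y | X.markSigma n]) ω := by
  have hp : Measurable[(X.jumpSigma n).prod inferInstance] fun p => ENNReal.ofReal (h n p) :=
    ENNReal.measurable_ofReal.comp (hY.measurable n)
  have hn : Measurable[(X.jumpSigma n).prod inferInstance] fun p => ENNReal.ofReal (-h n p) :=
    ENNReal.measurable_ofReal.comp (hY.measurable n).neg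
  have hpm := measurable_lintegral_sub (hκ n).isProbabilityMeasure (hκ n).measurable hp
  have hnm := measurable_lintegral_sub (hκ n).isProbabilityMeasure (hκ n).measurable hn
  set up := fun ω => ∫⁻ z, ENNReal.ofReal (h n (ω, z)) ∂κ n ω with hup
  set un := fun ω => ∫⁻ z, ENNReal.ofReal (-h n (ω, z)) ∂κ n ω with hun
  set F : Set Ω := {ω | X.T n ω ≠ ∞} with hF
  have hFm : MeasurableSet[X.markSigma n] F :=
    X.measurable_T_markSigma n (measurableSet_singleton ∞).compl
  set U : Ω → ℝ := F.indicator fun ω => (up ω).toReal - (un ω).toReal with hU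
  have hUm : Measurable[X.markSigma n] U :=
    X.measurable_indicator_markSigma (hpm.ennreal_toReal.sub hnm.ennreal_toReal)
  have hle := X.jumpSigma_le n
  have key : ∀ A, MeasurableSet[X.markSigma n] A →
      IntegrableOn (fun ω => (up ω).toReal - (un ω).toReal) A P ∧
      ∫ ω in A, ((up ω).toReal - (un ω).toReal) ∂P = ∫ ω in A, Y ω ∂P := by
    intro A hA
    have hA' := X.markSigma_le_jumpSigma n _ hA
    rw [← hY.setIntegral_comp hYi n (X.markSigma_le_succ n _ hA)]
    exact integral_toReal_sub_toReal (hY.integrable_comp n).integrableOn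
      (hpm.mono hle le_rfl).aemeasurable (hnm.mono hle le_rfl).aemeasurable
      (setLIntegral_comp_prodMk_eq hle (X.measurable_T_ξ (n + 1)) (hκ n).isProbabilityMeasure
        (hκ n).measurable (hκ n).setLIntegral hp hA')
      (setLIntegral_comp_prodMk_eq hle (X.measurable_T_ξ (n + 1)) (hκ n).isProbabilityMeasure
        (hκ n).measurable (hκ n).setLIntegral hn hA')
  have hFm' := X.markSigma_le n _ hFm
  -- The law `κ n` is only known to be `F_{T n}`-measurable; cutting down to `F = {T n < ∞}` makes
  -- its integral `markSigma n`-measurable.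
  have h1 : U =ᵐ[P] P[F.indicator Y | X.markSigma n] := by
    refine ae_eq_condExp_of_forall_setIntegral_eq (X.markSigma_le n) (hYi.indicator hFm')
      (fun A hA _ => ?_) (fun A hA _ => ?_) hUm.stronglyMeasurable.aestronglyMeasurable
    · rw [hU, integrableOn_indicator_iff hFm']
      exact (key _ (hFm.inter hA)).1
    · rw [hU, setIntegral_indicator hFm', setIntegral_indicator hFm']
      exact (key _ (hA.inter hFm)).2
  filter_upwards [h1, condExp_indicator hYi hFm, hY.ae_integrable hκ n] with ω hω1 hω2 hω3 hωF
  rw [hω2, hU, indicator_of_mem (show ω ∈ F from hωF), indicator_of_mem (show ω ∈ F from hωF)] at hω1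
  rw [← hω1, integral_eq_lintegral_pos_part_sub_lintegral_neg_part hω3]

/-- Between two jumps, the conditional expectation given the present is the mean of the jump law
after the present time. -/
theorem IsJumpVersion.ae_condExp_filtration_eq (hY : X.IsJumpVersion Y h) (hYi : Integrable Y P)
    (hκ : ∀ n, X.IsRegularJumpLaw n (κ n)) (n : ℕ) (t : ℝ≥0) :
    ∀ᵐ ω ∂P, X.T n ω ≤ t → t < X.T (n + 1) ω →
      (P[Y | X.filtration t]) ω = condMean (κ n ω) (fun z => h n (ω, z)) t := by
  have hp : Measurable[(X.jumpSigma n).prod inferInstance] fun p => ENNReal.ofReal (h n p) :=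
    ENNReal.measurable_ofReal.comp (hY.measurable n)
  have hn : Measurable[(X.jumpSigma n).prod inferInstance] fun p => ENNReal.ofReal (-h n p) :=
    ENNReal.measurable_ofReal.comp (hY.measurable n).neg
  have hpm := measurable_condTail_const_sub (hκ n).isProbabilityMeasure (hκ n).measurable hp t
  have hnm := measurable_condTail_const_sub (hκ n).isProbabilityMeasure (hκ n).measurable hn t
  have hcm : Measurable[X.jumpSigma n] fun ω => condMean (κ n ω) (fun z => h n (ω, z)) t :=
    hpm.ennreal_toReal.sub hnm.ennreal_toReal
  set G : Set Ω := {ω | X.T n ω ≤ t} with hG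
  set D : Set Ω := {ω | t < X.T (n + 1) ω} with hD
  have hGm : MeasurableSet[X.filtration t] G := X.isStoppingTime_T n t
  have hDm : MeasurableSet[X.filtration t] D := by
    have e : D = {ω | X.T (n + 1) ω ≤ t}ᶜ := by ext ω; simp [hD]
    rw [e]
    exact (X.isStoppingTime_T (n + 1) t).compl
  have hGD := hDm.inter hGm
  set U : Ω → ℝ := D.indicator (G.indicator fun ω => condMean (κ n ω) (fun z => h n (ω, z)) t)
    with hU
  have hUm : Measurable[X.filtration t] U :=
    (X.measurable_indicator_filtration hcm t).indicator hDm
  have hU' : U = (D ∩ G).indicator fun ω => condMean (κ n ω) (fun z => h n (ω, z)) t := by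
    rw [hU, indicator_indicator]
  have hle := X.jumpSigma_le n
  have key : ∀ A, MeasurableSet[X.filtration t] A →
      IntegrableOn (fun ω => condMean (κ n ω) (fun z => h n (ω, z)) t) (A ∩ (D ∩ G)) P ∧
      ∫ ω in A ∩ (D ∩ G), condMean (κ n ω) (fun z => h n (ω, z)) t ∂P =
        ∫ ω in A ∩ (D ∩ G), Y ω ∂P := by
    intro A hA
    obtain ⟨B, hB, hBA⟩ := X.exists_markSigma_iff n hA
    -- An event of `F_t` is traded for an event of the first `n` jumps, as required for conditioning
    -- with `κ n`.
    have e : A ∩ (D ∩ G) = (B ∩ G) ∩ {ω | t < X.T (n + 1) ω} := by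
      ext ω
      simp only [mem_inter_iff, hD, mem_ofPred_eq]
      constructor
      · rintro ⟨h1, h2, h3⟩
        exact ⟨⟨(hBA ω h2).1 h1, h3⟩, h2⟩
      · rintro ⟨⟨h1, h3⟩, h2⟩
        exact ⟨(hBA ω h2).2 h1, h2, h3⟩
    have hC : MeasurableSet[X.markSigma n] (B ∩ G) :=
      hB.inter (X.measurable_T_markSigma n measurableSet_Iic)
    have hC' := X.markSigma_le_jumpSigma n _ hC
    rw [e, ← hY.setIntegral_comp hYi n ((X.markSigma_le_succ n _ hC).inter
      (X.measurable_T_markSigma (n + 1) (measurableSet_Ioi (a := (t : ℝ≥0∞)))) :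
      MeasurableSet[X.markSigma (n + 1)] (B ∩ G ∩ {ω | t < X.T (n + 1) ω}))]
    exact integral_toReal_sub_toReal (hY.integrable_comp n).integrableOn
      (hpm.mono hle le_rfl).aemeasurable (hnm.mono hle le_rfl).aemeasurable
      (setLIntegral_condTail_eq hle (X.measurable_T_ξ (n + 1)) (hκ n).isProbabilityMeasure
        (hκ n).measurable (hκ n).setLIntegral hp hC' (t : ℝ≥0∞))
      (setLIntegral_condTail_eq hle (X.measurable_T_ξ (n + 1)) (hκ n).isProbabilityMeasure
        (hκ n).measurable (hκ n).setLIntegral hn hC' (t : ℝ≥0∞))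
  have hGD' := X.filtration.le t _ hGD
  have h1 : U =ᵐ[P] P[(D ∩ G).indicator Y | X.filtration t] := by
    refine ae_eq_condExp_of_forall_setIntegral_eq (X.filtration.le t) (hYi.indicator hGD')
      (fun A hA _ => ?_) (fun A hA _ => ?_) hUm.stronglyMeasurable.aestronglyMeasurable
    · rw [hU', integrableOn_indicator_iff hGD', inter_comm]
      exact (key A hA).1
    · rw [hU', setIntegral_indicator hGD', setIntegral_indicator hGD']
      exact (key A hA).2
  filter_upwards [h1, condExp_indicator hYi hGD] with ω hω1 hω2 hωG hωD
  have hω : ω ∈ D ∩ G := ⟨hωD, hωG⟩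
  rw [hω2, hU', indicator_of_mem hω, indicator_of_mem hω] at hω1
  exact hω1.symm

end MarkedPointProcess

/-! ### The hazard measure and the compensator of a single jump. -/

theorem condTail_ne_top {τ E : Type*} [LinearOrder τ] [MeasurableSpace τ] [MeasurableSpace E]
    {μ : Measure (τ × E)} {φ : τ × E → ℝ≥0∞} (hφ : ∫⁻ z, φ z ∂μ ≠ ∞) (s : τ) :
    condTail μ φ s ≠ ∞ := by
  rw [condTail]
  by_cases h0 : μ (Ioi s ×ˢ univ) = 0
  · simp [setLIntegral_measure_zero _ _ h0]
  · exact ENNReal.mul_ne_top (ENNReal.inv_ne_top.2 h0)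
      (ne_top_of_le_ne_top hφ (setLIntegral_le_lintegral _ _))

theorem measurable_condTail_right {τ E : Type*} [LinearOrder τ] [TopologicalSpace τ]
    [OrderTopology τ] [SecondCountableTopology τ] [MeasurableSpace τ] [BorelSpace τ]
    [MeasurableSpace E] (μ : Measure (τ × E)) [IsProbabilityMeasure μ] {φ : τ × E → ℝ≥0∞}
    (hφ : Measurable φ) : Measurable (condTail μ φ) := by
  have h1 := measurable_condTail (α := Unit) (κ := fun _ => μ) (fun _ => inferInstance)
    (fun B _ => measurable_const) (hφ.comp measurable_snd)
  exact Measurable.comp (g := fun p : Unit × τ => condTail μ φ p.2) (f := fun t => ((), t)) h1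
    (measurable_const.prodMk measurable_id)

theorem measure_sum_eq_finset_sum {α : Type*} [MeasurableSpace α] {μ : ℕ → Measure α} {n : ℕ}
    (h : ∀ k, n < k → μ k = 0) : Measure.sum μ = ∑ k ∈ Finset.range (n + 1), μ k := by
  ext s hs
  rw [Measure.sum_apply _ hs, Measure.finsetSum_apply]
  exact tsum_eq_sum fun k hk => by
    rw [h k (by simpa using hk)]
    rfl

namespace MarkedPointProcess

variable {Ω E : Type*} [mΩ : MeasurableSpace Ω] [mE : MeasurableSpace E] {P : Measure Ω}

/-- The cumulative hazard measure `-(F_{u-})⁻¹ dF_u` of a law on `[0,∞] × E`. -/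
noncomputable def hazard (μ : Measure (ℝ≥0∞ × E)) : Measure (ℝ≥0 × E) :=
  (finiteTimePart μ).withDensity fun z => (survivalLeft μ z.1)⁻¹

theorem measurable_survivalLeft (μ : Measure (ℝ≥0∞ × E)) : Measurable (survivalLeft μ) :=
  Antitone.measurable fun _ _ h => measure_mono
    (prod_mono (Ici_subset_Ici.2 (ENNReal.coe_le_coe.2 h)) Subset.rfl)

theorem measurableEmbedding_coe_prod :
    MeasurableEmbedding (Prod.map ((↑) : ℝ≥0 → ℝ≥0∞) (id : E → E)) :=
  ENNReal.isOpenEmbedding_coe.measurableEmbedding.prodMap MeasurableEmbedding.id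

theorem setLIntegral_hazard (μ : Measure (ℝ≥0∞ × E)) (r : ℝ≥0) {φ : ℝ≥0∞ × E → ℝ≥0∞}
    (hφ : Measurable φ) :
    ∫⁻ z in Ioc 0 r ×ˢ univ, φ (z.1, z.2) ∂hazard μ =
      ∫⁻ z in Ioc 0 (r : ℝ≥0∞) ×ˢ univ, (μ (Ici z.1 ×ˢ univ))⁻¹ * φ z ∂μ := by
  have he := measurableEmbedding_coe_prod (E := E)
  have hs : MeasurableSet (Ioc 0 r ×ˢ (univ : Set E)) := measurableSet_Ioc.prod MeasurableSet.univ
  have himg : Prod.map ((↑) : ℝ≥0 → ℝ≥0∞) (id : E → E) '' (Ioc 0 r ×ˢ univ) =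
      Ioc 0 (r : ℝ≥0∞) ×ˢ univ := by
    rw [prodMap_image_prod, image_univ, Set.range_id]
    congr 1
    ext u
    simp only [mem_image, mem_Ioc]
    constructor
    · rintro ⟨x, hx, rfl⟩
      exact_mod_cast hx
    · intro hu
      lift u to ℝ≥0 using ne_top_of_le_ne_top ENNReal.coe_ne_top hu.2
      exact ⟨u, by exact_mod_cast hu, rfl⟩
  have hd : Measurable fun z : ℝ≥0 × E => (survivalLeft μ z.1)⁻¹ :=
    ((measurable_survivalLeft μ).comp measurable_fst).inv
  have hφ' : Measurable fun z : ℝ≥0 × E => φ (z.1, z.2) := hφ.comp he.measurable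
  rw [hazard, setLIntegral_withDensity_eq_setLIntegral_mul _ hd hφ' hs, finiteTimePart,
    he.restrict_comap, himg]
  have hmap : ((μ.restrict (Ioc 0 (r : ℝ≥0∞) ×ˢ univ)).comap (Prod.map ((↑) : ℝ≥0 → ℝ≥0∞) id)).map
      (Prod.map ((↑) : ℝ≥0 → ℝ≥0∞) (id : E → E)) = μ.restrict (Ioc 0 (r : ℝ≥0∞) ×ˢ univ) := by
    rw [he.map_comap, Measure.restrict_restrict he.measurableSet_range, ← himg,
      inter_eq_right.2 (image_subset_range _ _)]
  conv_rhs => rw [← hmap]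
  rw [he.lintegral_map]
  rfl

/-- The compensated value process of a single jump: the compensator of `f - condMean μ f` is the
loss of conditional mean. -/
theorem integral_hazard (μ : Measure (ℝ≥0∞ × E)) [IsProbabilityMeasure μ] {f : ℝ≥0∞ × E → ℝ}
    (hf : Measurable f) (hfi : Integrable f μ) {r : ℝ≥0} (h0 : μ (Iic 0 ×ˢ univ) = 0)
    (hr : μ (Ici (r : ℝ≥0∞) ×ˢ univ) ≠ 0) :
    IntegrableOn (fun z : ℝ≥0 × E => f (z.1, z.2) - condMean μ f z.1) (Ioc 0 r ×ˢ univ) (hazard μ) ∧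
    ∫ z in Ioc 0 r ×ˢ univ, (f (z.1, z.2) - condMean μ f z.1) ∂hazard μ =
      ∫ z, f z ∂μ - condMean μ f r := by
  have hcoe : Measurable fun z : ℝ≥0 × E => ((z.1 : ℝ≥0∞), z.2) :=
    measurableEmbedding_coe_prod.measurable
  have key : ∀ φ : ℝ≥0∞ × E → ℝ≥0∞, Measurable φ → ∫⁻ z, φ z ∂μ ≠ ∞ →
      ∃ a b : ℝ≥0∞, a ≠ ∞ ∧ b ≠ ∞ ∧ ∫⁻ z in Ioc 0 r ×ˢ univ, φ (z.1, z.2) ∂hazard μ = a ∧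
        ∫⁻ z in Ioc 0 r ×ˢ univ, condTail μ φ z.1 ∂hazard μ = b ∧
        a.toReal - b.toReal = (∫⁻ z, φ z ∂μ).toReal - (condTail μ φ r).toReal := by
    intro φ hφ hφi
    refine ⟨_, _, ?_, ?_, rfl, rfl, ?_⟩
    all_goals
      -- The identity for the tail mean lives on `Iic r`, the hazard integral on `]0,r]`; `h0` says
      -- that `μ` does not see the difference.
      have hae : (Ioc 0 (r : ℝ≥0∞) ×ˢ (univ : Set E)) =ᵐ[μ] (Iic (r : ℝ≥0∞) ×ˢ (univ : Set E)) := by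
        have h1 : ∀ᵐ z ∂μ, z ∉ Iic (0 : ℝ≥0∞) ×ˢ (univ : Set E) := measure_eq_zero_iff_ae_notMem.1 h0
        filter_upwards [h1] with z hz
        have hz' : 0 < z.1 := pos_iff_ne_zero.2 (by simpa using hz)
        exact propext ⟨fun h => ⟨h.1.2, trivial⟩, fun h => ⟨⟨hz', h.1⟩, trivial⟩⟩
      have ha := setLIntegral_hazard μ r hφ
      have hb := setLIntegral_hazard μ r ((measurable_condTail_right μ hφ).comp
        (measurable_fst (α := ℝ≥0∞) (β := E)))
      simp only [Function.comp_apply] at hb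
      rw [setLIntegral_congr hae] at ha hb
      have hid := lintegral_add_lintegral_condTail μ hφ (r : ℝ≥0∞)
      rw [← ha, ← hb] at hid
      -- Up to time `r` the density `1 / F_-` is at most its value at `r`, which is finite by `hr`.
      have hafin : ∫⁻ z in Ioc 0 r ×ˢ univ, φ (z.1, z.2) ∂hazard μ ≠ ∞ := by
        rw [ha]
        refine ne_top_of_le_ne_top (ENNReal.mul_ne_top (ENNReal.inv_ne_top.2 hr) hφi) ?_
        rw [← lintegral_const_mul _ hφ]
        refine (setLIntegral_mono' (measurableSet_Iic.prod MeasurableSet.univ)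
          (g := fun z => (μ (Ici (r : ℝ≥0∞) ×ˢ univ))⁻¹ * φ z) fun z hz => ?_).trans
          (setLIntegral_le_lintegral _ _)
        gcongr
        exact hz.1
      have hc := condTail_ne_top hφi (r : ℝ≥0∞)
      -- The identity `hid` itself bounds this term by two finite ones.
      have hbfin : ∫⁻ z in Ioc 0 r ×ˢ univ, condTail μ φ z.1 ∂hazard μ ≠ ∞ := by
        refine ne_top_of_le_ne_top (ENNReal.add_ne_top.2 ⟨hafin, hc⟩) ?_
        rw [← hid]
        exact le_add_self
    · exact hafin
    · exact hbfin
    · have := congrArg ENNReal.toReal hid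
      rw [ENNReal.toReal_add hφi hbfin, ENNReal.toReal_add hafin hc] at this
      linarith
  have hpm : Measurable fun z => ENNReal.ofReal (f z) := ENNReal.measurable_ofReal.comp hf
  have hnm : Measurable fun z => ENNReal.ofReal (-f z) := ENNReal.measurable_ofReal.comp hf.neg
  obtain ⟨a, b, ha, hb, ha', hb', hab⟩ := key _ hpm hfi.lintegral_lt_top.ne
  obtain ⟨a₂, b₂, ha₂, hb₂, ha₂', hb₂', hab₂⟩ := key _ hnm hfi.neg.lintegral_lt_top.ne
  have main : ∀ (ψ : ℝ≥0 × E → ℝ≥0∞) (c : ℝ≥0∞), Measurable ψ → c ≠ ∞ →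
      ∫⁻ z in Ioc 0 r ×ˢ univ, ψ z ∂hazard μ = c →
      IntegrableOn (fun z => (ψ z).toReal) (Ioc 0 r ×ˢ univ) (hazard μ) ∧
        ∫ z in Ioc 0 r ×ˢ univ, (ψ z).toReal ∂hazard μ = c.toReal := by
    intro ψ c hψ hc hψc
    have hne : ∫⁻ z in Ioc 0 r ×ˢ univ, ψ z ∂hazard μ ≠ ∞ := hψc ▸ hc
    exact ⟨integrable_toReal_of_lintegral_ne_top hψ.aemeasurable hne, by
      rw [integral_toReal hψ.aemeasurable (ae_lt_top hψ hne), hψc]⟩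
  have hct : ∀ φ : ℝ≥0∞ × E → ℝ≥0∞, Measurable φ →
      Measurable fun z : ℝ≥0 × E => condTail μ φ z.1 := fun φ hφ =>
    (measurable_condTail_right μ hφ).comp (measurable_coe_nnreal_ennreal.comp measurable_fst)
  obtain ⟨i1, e1⟩ := main (fun z => ENNReal.ofReal (f (z.1, z.2))) a (hpm.comp hcoe) ha ha'
  obtain ⟨i2, e2⟩ := main _ b (hct _ hpm) hb hb'
  obtain ⟨i3, e3⟩ := main (fun z => ENNReal.ofReal (-f (z.1, z.2))) a₂ (hnm.comp hcoe) ha₂ ha₂'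
  obtain ⟨i4, e4⟩ := main _ b₂ (hct _ hnm) hb₂ hb₂'
  have hfun : (fun z : ℝ≥0 × E => f (z.1, z.2) - condMean μ f z.1) = fun z =>
      ((ENNReal.ofReal (f (z.1, z.2))).toReal - (condTail μ (fun z => ENNReal.ofReal (f z)) z.1).toReal)
      - ((ENNReal.ofReal (-f (z.1, z.2))).toReal
        - (condTail μ (fun z => ENNReal.ofReal (-f z)) z.1).toReal) := by
    ext z
    have h1 : f (z.1, z.2) = (ENNReal.ofReal (f (z.1, z.2))).toReal
        - (ENNReal.ofReal (-f (z.1, z.2))).toReal := by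
      rw [ENNReal.toReal_ofReal', ENNReal.toReal_ofReal']
      rcases le_total 0 (f (z.1, z.2)) with h | h
      · rw [max_eq_left h, max_eq_right (by linarith)]; ring
      · rw [max_eq_right h, max_eq_left (by linarith)]; ring
    rw [condMean]
    linarith
  rw [hfun]
  refine ⟨(i1.sub i2).sub (i3.sub i4), ?_⟩
  have s1 := integral_sub i1 i2
  have s2 := integral_sub i3 i4
  refine (integral_sub (i1.sub i2) (i3.sub i4)).trans ?_
  simp only [Pi.sub_apply]
  rw [s1, s2]
  rw [e1, e2, e3, e4, integral_eq_lintegral_pos_part_sub_lintegral_neg_part hfi, condMean]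
  linarith

end MarkedPointProcess

/-! ### The representation along a single path. -/

theorem measurableSingletonClass_of_blackwellSpace (E : Type*) [MeasurableSpace E]
    [BlackwellSpace E] : MeasurableSingletonClass E where
  measurableSet_singleton x := by
    have h := MeasurableSpace.measurable_mapNatBool E
      (measurableSet_singleton (MeasurableSpace.mapNatBool E x))
    rwa [← image_singleton, (MeasurableSpace.injective_mapNatBool E).preimage_image] at h

namespace MarkedPointProcess

variable {Ω E : Type*} [mΩ : MeasurableSpace Ω] [mE : MeasurableSpace E] {P : Measure Ω}

theorem ae_hazard_lt (μ : Measure (ℝ≥0∞ × E)) {a : ℝ≥0∞} (h : μ {z | z.1 ≤ a ∧ z.1 ≠ ∞} = 0) :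
    ∀ᵐ z ∂hazard μ, a < z.1 := by
  refine (withDensity_absolutelyContinuous _ _).ae_le (?_ : ∀ᵐ z ∂finiteTimePart μ, a < z.1)
  have hs : MeasurableSet {z : ℝ≥0 × E | (z.1 : ℝ≥0∞) ≤ a} :=
    (measurable_coe_nnreal_ennreal.comp measurable_fst) measurableSet_Iic
  refine ae_iff.2 ?_
  simp only [not_lt]
  rw [finiteTimePart, measurableEmbedding_coe_prod.comap_apply]
  refine measure_mono_null ?_ h
  rintro _ ⟨z, hz, rfl⟩
  exact ⟨hz, ENNReal.coe_ne_top⟩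

/-- A path along which the representation can be computed: `f n` is the value after the jump
`n + 1` as a function of its time and place, and `y n` is the value just after the jump `n`. -/
structure IsRegularPath (X : MarkedPointProcess P E) (κ : ℕ → Ω → Measure (ℝ≥0∞ × E)) (ω : Ω)
    (f : ℕ → ℝ≥0∞ × E → ℝ) (y : ℕ → ℝ) : Prop where
  tendsto : Tendsto (fun n => X.T n ω) atTop (𝓝 ∞)
  isProbabilityMeasure : ∀ n, IsProbabilityMeasure (κ n ω)
  measurable : ∀ n, Measurable (f n)
  integrable : ∀ n, Integrable (f n) (κ n ω)
  null : ∀ n, κ n ω {z | z.1 ≤ X.T n ω ∧ z.1 ≠ ∞} = 0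
  survival : ∀ n, κ n ω (Ici (X.T (n + 1) ω) ×ˢ univ) ≠ 0
  integral_eq : ∀ n, X.T n ω ≠ ∞ → ∫ z, f n z ∂κ n ω = y n
  jump_eq : ∀ n, f n (X.T (n + 1) ω, X.ξ (n + 1) ω) = y (n + 1)

/-- `G` is the integrand that represents the values along the path `ω`. -/
def IsIntegrand (X : MarkedPointProcess P E) (κ : ℕ → Ω → Measure (ℝ≥0∞ × E)) (ω : Ω)
    (f : ℕ → ℝ≥0∞ × E → ℝ) (G : ℝ≥0 × E → ℝ) : Prop :=
  ∀ n z, X.T n ω < z.1 → z.1 ≤ X.T (n + 1) ω →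
    G z = f n (z.1, z.2) - condMean (κ n ω) (f n) z.1

variable {X : MarkedPointProcess P E} {κ : ℕ → Ω → Measure (ℝ≥0∞ × E)} {ω : Ω}
  {f : ℕ → ℝ≥0∞ × E → ℝ} {y : ℕ → ℝ} {G : ℝ≥0 × E → ℝ}

theorem compensator_restrict (X : MarkedPointProcess P E) (κ : ℕ → Ω → Measure (ℝ≥0∞ × E)) (n : ℕ)
    (ω : Ω) {t r : ℝ≥0} (hr : (r : ℝ≥0∞) = min (t : ℝ≥0∞) (X.T (n + 1) ω)) :
    (X.compensator κ n ω).restrict (Ioc 0 t ×ˢ univ) =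
      (hazard (κ n ω)).restrict (Ioc 0 r ×ˢ univ) := by
  rw [compensator, Measure.restrict_restrict (measurableSet_Ioc.prod MeasurableSet.univ), hazard]
  congr 1
  ext z
  have h : z.1 ≤ r ↔ z.1 ≤ t ∧ (z.1 : ℝ≥0∞) ≤ X.T (n + 1) ω := by
    rw [← ENNReal.coe_le_coe, hr, le_min_iff, ENNReal.coe_le_coe]
  simp only [mem_inter_iff, mem_prod, mem_Ioc, mem_univ, and_true, mem_ofPred_eq, h]
  tauto

theorem IsRegularPath.compensator_restrict_eq_zero (h : X.IsRegularPath κ ω f y) {n : ℕ} {t : ℝ≥0}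
    (ht : t < X.T n ω) : (X.compensator κ n ω).restrict (Ioc 0 t ×ˢ univ) = 0 := by
  have hmin : (t : ℝ≥0∞) = min (t : ℝ≥0∞) (X.T (n + 1) ω) :=
    (min_eq_left (ht.le.trans (X.T_mono ω n.le_succ))).symm
  rw [compensator_restrict X κ n ω hmin, Measure.restrict_eq_zero]
  refine measure_eq_zero_iff_ae_notMem.2 ?_
  filter_upwards [ae_hazard_lt _ (h.null n)] with z hz hz'
  exact absurd (hz.trans_le (ENNReal.coe_le_coe.2 hz'.1.2)) (not_lt.2 ht.le)

/-- Up to `t ∧ T (n + 1)` the compensator is the hazard measure, which charges only times after `T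
n`; there `G` has the form required by `integral_hazard`, and the mean of `f n` is `y n`. -/
theorem IsRegularPath.integral_compensator (h : X.IsRegularPath κ ω f y)
    (hG : X.IsIntegrand κ ω f G) {n : ℕ} {t : ℝ≥0} (ht : X.T n ω ≤ t) :
    IntegrableOn G (Ioc 0 t ×ˢ univ) (X.compensator κ n ω) ∧
      ∫ z in Ioc 0 t ×ˢ univ, G z ∂X.compensator κ n ω =
        y n - condMean (κ n ω) (f n) (min (t : ℝ≥0∞) (X.T (n + 1) ω)) := by
  have := h.isProbabilityMeasure n
  obtain ⟨r, hr⟩ : ∃ r : ℝ≥0, (r : ℝ≥0∞) = min (t : ℝ≥0∞) (X.T (n + 1) ω) :=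
    ⟨_, ENNReal.coe_toNNReal (ne_top_of_le_ne_top ENNReal.coe_ne_top (min_le_left _ _))⟩
  have hG' : G =ᵐ[(hazard (κ n ω)).restrict (Ioc 0 r ×ˢ univ)]
      fun z => f n (z.1, z.2) - condMean (κ n ω) (f n) z.1 := by
    filter_upwards [ae_restrict_of_ae (ae_hazard_lt _ (h.null n)),
      ae_restrict_mem (measurableSet_Ioc.prod MeasurableSet.univ)] with z hz hz'
    refine hG n z hz ((ENNReal.coe_le_coe.2 hz'.1.2).trans ?_)
    rw [hr]
    exact min_le_right _ _
  have h0 : κ n ω (Iic 0 ×ˢ univ) = 0 := by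
    refine measure_mono_null (t := {z | z.1 ≤ X.T n ω ∧ z.1 ≠ ∞}) (fun z hz => ?_) (h.null n)
    exact ⟨le_trans hz.1 zero_le, ne_top_of_le_ne_top ENNReal.zero_ne_top hz.1⟩
  have hsv : κ n ω (Ici (r : ℝ≥0∞) ×ˢ univ) ≠ 0 := fun h1 => h.survival n
    (measure_mono_null (prod_mono (Ici_subset_Ici.2 (hr ▸ min_le_right _ _)) Subset.rfl) h1)
  obtain ⟨hi, he⟩ := integral_hazard (κ n ω) (h.measurable n) (h.integrable n) h0 hsv
  rw [IntegrableOn, X.compensator_restrict κ n ω hr, integral_congr_ae hG', he,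
    h.integral_eq n (ne_top_of_le_ne_top ENNReal.coe_ne_top ht), hr]
  exact ⟨hi.congr hG'.symm, rfl⟩

theorem jumpMeasure_restrict_eq_zero (X : MarkedPointProcess P E) {n : ℕ} {t : ℝ≥0} {ω : Ω}
    (ht : t < X.T (n + 1) ω) : (X.jumpMeasure n ω).restrict (Ioc 0 t ×ˢ univ) = 0 := by
  rw [jumpMeasure]
  split_ifs with h
  · simp
  · rw [Measure.restrict_eq_zero, Measure.dirac_apply' _ (measurableSet_Ioc.prod MeasurableSet.univ),
      indicator_of_notMem]
    rintro ⟨⟨-, h1⟩, -⟩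
    rw [← ENNReal.coe_le_coe, ENNReal.coe_toNNReal h] at h1
    exact absurd ht (not_lt.2 h1)

variable [BlackwellSpace E]

theorem IsRegularPath.integral_jumpMeasure (h : X.IsRegularPath κ ω f y)
    (hG : X.IsIntegrand κ ω f G) {n : ℕ} {t : ℝ≥0} (ht : X.T (n + 1) ω ≤ t) :
    IntegrableOn G (Ioc 0 t ×ˢ univ) (X.jumpMeasure n ω) ∧
      ∫ z in Ioc 0 t ×ˢ univ, G z ∂X.jumpMeasure n ω =
        y (n + 1) - condMean (κ n ω) (f n) (X.T (n + 1) ω) := by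
  have hfin : X.T (n + 1) ω ≠ ∞ := ne_top_of_le_ne_top ENNReal.coe_ne_top ht
  have hlt := X.T_lt n ω (ne_top_of_le_ne_top hfin (X.T_mono ω n.le_succ))
  have hcoe := ENNReal.coe_toNNReal hfin
  have hmem : ((X.T (n + 1) ω).toNNReal, X.ξ (n + 1) ω) ∈ Ioc 0 t ×ˢ (univ : Set E) := by
    refine ⟨⟨?_, ?_⟩, trivial⟩
    · exact ENNReal.toNNReal_pos (zero_le.trans_lt hlt).ne' hfin
    · rw [← ENNReal.coe_le_coe]
      exact hcoe.trans_le ht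
  have hval : G ((X.T (n + 1) ω).toNNReal, X.ξ (n + 1) ω) =
      y (n + 1) - condMean (κ n ω) (f n) (X.T (n + 1) ω) := by
    rw [hG n _ (by rwa [hcoe]) (by rw [hcoe]), hcoe, h.jump_eq]
  classical
  have := measurableSingletonClass_of_blackwellSpace E
  rw [IntegrableOn, jumpMeasure, if_neg hfin,
    restrict_dirac' (measurableSet_Ioc.prod MeasurableSet.univ), if_pos hmem]
  exact ⟨integrable_dirac (by simp), by rw [integral_dirac, hval]⟩

/-- The representation along a regular path. -/
theorem IsRegularPath.qIntegral_eq (h : X.IsRegularPath κ ω f y) (hG : X.IsIntegrand κ ω f G)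
    {n : ℕ} {t : ℝ≥0} (ht : X.T n ω ≤ t) (ht' : t < X.T (n + 1) ω) :
    X.QIntegrable κ ω t G ∧ X.qIntegral κ ω t G = condMean (κ n ω) (f n) t - y 0 := by
  have hS : MeasurableSet (Ioc 0 t ×ˢ (univ : Set E)) := measurableSet_Ioc.prod MeasurableSet.univ
  have hp : (X.totalJumpMeasure ω).restrict (Ioc 0 t ×ˢ univ) =
      ∑ k ∈ Finset.range n, (X.jumpMeasure k ω).restrict (Ioc 0 t ×ˢ univ) := by
    rw [totalJumpMeasure, Measure.restrict_sum _ hS, measure_sum_eq_finset_sum (n := n),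
      Finset.sum_range_succ, X.jumpMeasure_restrict_eq_zero ht', add_zero]
    exact fun k hk => X.jumpMeasure_restrict_eq_zero (ht'.trans_le (X.T_mono ω (by omega)))
  -- One more term than for the jumps: the compensator of the jump `n + 1` already grows after `T
  -- n`. Its term, with `min = t`, produces `condMean (κ n ω) (f n) t`, and all the others
  -- telescope.
  have hc : (X.totalCompensator κ ω).restrict (Ioc 0 t ×ˢ univ) =
      ∑ k ∈ Finset.range (n + 1), (X.compensator κ k ω).restrict (Ioc 0 t ×ˢ univ) := by
    rw [totalCompensator, Measure.restrict_sum _ hS, measure_sum_eq_finset_sum (n := n)]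
    exact fun k hk => h.compensator_restrict_eq_zero (ht'.trans_le (X.T_mono ω hk))
  have hp' : ∀ k ∈ Finset.range n, _ := fun k hk => h.integral_jumpMeasure hG
    ((X.T_mono ω (Nat.succ_le_of_lt (Finset.mem_range.1 hk))).trans ht)
  have hc' : ∀ k ∈ Finset.range (n + 1), _ := fun k hk => h.integral_compensator hG
    ((X.T_mono ω (Nat.lt_succ_iff.1 (Finset.mem_range.1 hk))).trans ht)
  refine ⟨⟨?_, ?_⟩, ?_⟩
  · rw [IntegrableOn, hp]
    exact integrable_finsetSum_measure.2 fun k hk => (hp' k hk).1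
  · rw [IntegrableOn, hc]
    exact integrable_finsetSum_measure.2 fun k hk => (hc' k hk).1
  · rw [qIntegral, hp, hc, integral_finsetSum_measure fun k hk => (hp' k hk).1,
      integral_finsetSum_measure fun k hk => (hc' k hk).1,
      Finset.sum_congr rfl fun k hk => (hp' k hk).2, Finset.sum_congr rfl fun k hk => (hc' k hk).2,
      Finset.sum_range_succ, min_eq_left ht'.le]
    have e : ∀ k ∈ Finset.range n, y k - condMean (κ k ω) (f k) (min (t : ℝ≥0∞) (X.T (k + 1) ω)) =
        y k - condMean (κ k ω) (f k) (X.T (k + 1) ω) := fun k hk => by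
      rw [min_eq_right ((X.T_mono ω (Nat.succ_le_of_lt (Finset.mem_range.1 hk))).trans ht)]
    rw [Finset.sum_congr rfl e]
    have := Finset.sum_range_sub y n
    simp only [Finset.sum_sub_distrib] at this ⊢
    linarith

theorem IsRegularPath.exists_le_lt (h : X.IsRegularPath κ ω f y) (t : ℝ≥0) :
    ∃ n, X.T n ω ≤ t ∧ t < X.T (n + 1) ω := by
  rcases X.exists_le_lt_or t ω with h1 | h1
  · exact h1
  · exact absurd (le_of_tendsto' h.tendsto h1) (by simp)

theorem IsJumpVersion.ae_isRegularPath [IsProbabilityMeasure P] {Y : Ω → ℝ}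
    {h : ℕ → Ω × (ℝ≥0∞ × E) → ℝ} (hY : X.IsJumpVersion Y h) (hYi : Integrable Y P)
    (hκ : ∀ n, X.IsRegularJumpLaw n (κ n)) :
    ∀ᵐ ω ∂P, X.IsRegularPath κ ω (fun n z => h n (ω, z)) (fun n => (P[Y | X.markSigma n]) ω) := by
  filter_upwards [X.tendsto_T, ae_all_iff.2 fun n => hY.ae_integrable hκ n,
    ae_all_iff.2 fun n => (hκ n).ae_Iic_T_eq_zero, ae_all_iff.2 fun n =>
    (hκ n).ae_Ici_T_succ_ne_zero, ae_all_iff.2 fun n => hY.ae_integral_eq hYi hκ n]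
    with ω h1 h2 h3 h4 h5
  exact ⟨h1, fun n => (hκ n).isProbabilityMeasure ω, fun n => hY.measurable_section n ω, h2, h3, h4,
    h5, fun n => (hY.condExp_eq n ω).symm⟩

end MarkedPointProcess

/-! ### Predictability of the integrand and the case of a closed martingale. -/

/-- Made for `S = {T n < t}`: on this set, `(t, ω) ↦ ω` is measurable from the predictable σ-algebra
to `F_{T n}`. -/
theorem measurable_indicator_comp_of_restrict {α γ : Type*} {mα : MeasurableSpace α}
    {mγ : MeasurableSpace γ} {S : Set α} (hS : MeasurableSet S) {Θ : α → γ}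
    (hΘ : Measurable fun a : S => Θ a) {F : γ → ℝ} (hF : Measurable F) :
    Measurable (S.indicator fun a => F (Θ a)) := by
  refine measurable_of_restrict_of_restrict_compl hS ?_ ?_
  · have e : (fun a : S => S.indicator (fun a => F (Θ a)) a) = F ∘ fun a : S => Θ a :=
      funext fun a => indicator_of_mem a.2 _
    exact (congrArg (fun f => Measurable f) e).mpr (hF.comp hΘ)
  · have e : (fun a : ↥Sᶜ => S.indicator (fun a => F (Θ a)) a) = fun _ => 0 :=
      funext fun a => indicator_of_notMem a.2 _
    exact (congrArg (fun f => Measurable f) e).mpr measurable_const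

theorem measurable_nat_of_preimage_singleton {α : Type*} {mα : MeasurableSpace α} {f : α → ℕ}
    (h : ∀ n, MeasurableSet (f ⁻¹' {n})) : Measurable f :=
  measurable_to_countable' h

theorem measurable_uncurry_of_countable {ι α : Type*} [Countable ι] [MeasurableSpace ι]
    [MeasurableSingletonClass ι] {mα : MeasurableSpace α} {f : ι → α → ℝ}
    (h : ∀ i, Measurable (f i)) : Measurable fun q : ι × α => f q.1 q.2 :=
  measurable_from_prod_countable_right h

namespace MarkedPointProcess

variable {Ω E : Type*} [mΩ : MeasurableSpace Ω] [mE : MeasurableSpace E] {P : Measure Ω}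

/-- The number of jumps strictly before time `t`. -/
noncomputable def jumpIndex (X : MarkedPointProcess P E) (p : ℝ≥0 × Ω) : ℕ :=
  sInf {n | p.1 ≤ X.T (n + 1) p.2}

theorem jumpIndex_eq (X : MarkedPointProcess P E) {p : ℝ≥0 × Ω} {n : ℕ} (h : X.T n p.2 < p.1)
    (h' : p.1 ≤ X.T (n + 1) p.2) : X.jumpIndex p = n := by
  refine IsLeast.csInf_eq ⟨h', fun m hm => ?_⟩
  by_contra! hmn
  exact absurd (h.trans_le (le_trans hm (X.T_mono p.2 hmn))) (lt_irrefl _)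

open scoped Classical in
/-- The integrand `∑ 1_{T n < t ≤ T (n + 1)} (h n (t, x) - F_t⁻¹ ∫_{]t,∞]} h n dF)`. -/
noncomputable def integrand (X : MarkedPointProcess P E) (κ : ℕ → Ω → Measure (ℝ≥0∞ × E))
    (h : ℕ → Ω × (ℝ≥0∞ × E) → ℝ) (t : ℝ≥0) (ω : Ω) (x : E) : ℝ :=
  -- This fails only at `t = 0`: for `t > 0`, minimality of the index, or `T 0 = 0` if the index is
  -- `0`, gives the inequality.
  if X.T (X.jumpIndex (t, ω)) ω < t then
    h (X.jumpIndex (t, ω)) (ω, (t, x)) - condMean (κ (X.jumpIndex (t, ω)) ω)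
      (fun z => h (X.jumpIndex (t, ω)) (ω, z)) t
  else 0

theorem isIntegrand_integrand (X : MarkedPointProcess P E) (κ : ℕ → Ω → Measure (ℝ≥0∞ × E))
    (h : ℕ → Ω × (ℝ≥0∞ × E) → ℝ) (ω : Ω) :
    X.IsIntegrand κ ω (fun n z => h n (ω, z)) fun z => X.integrand κ h z.1 ω z.2 := by
  intro n z h1 h2
  simp only [integrand]
  rw [X.jumpIndex_eq (p := (z.1, ω)) h1 h2, if_pos h1]

variable [BlackwellSpace E]

/-- An event known at `T n` may be used predictably strictly after `T n`: with `q` between `T n` and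
`t`, the set is a countable union of the rectangles `]q,∞[ × (A ∩ {T n ≤ q})`. -/
theorem measurableSet_predictable_T_lt (X : MarkedPointProcess P E) {n : ℕ} {A : Set Ω}
    (hA : MeasurableSet[X.jumpSigma n] A) :
    MeasurableSet[X.filtration.predictable] {p : ℝ≥0 × Ω | X.T n p.2 < p.1 ∧ p.2 ∈ A} := by
  obtain ⟨D, hDc, hD⟩ := NNReal.exists_countable_btwn
  have e : {p : ℝ≥0 × Ω | X.T n p.2 < p.1 ∧ p.2 ∈ A} =
      ⋃ q ∈ D, Ioi q ×ˢ (A ∩ {ω | X.T n ω ≤ q}) := by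
    ext p
    simp only [mem_ofPred_eq, mem_iUnion, mem_prod, mem_Ioi, mem_inter_iff, exists_prop]
    constructor
    · rintro ⟨h1, h2⟩
      obtain ⟨q, hq, hq1, hq2⟩ := hD h1
      exact ⟨q, hq, ENNReal.coe_lt_coe.1 hq2, h2, hq1.le⟩
    · rintro ⟨q, -, hq, h2, h3⟩
      exact ⟨h3.trans_lt (ENNReal.coe_lt_coe.2 hq), h2⟩
  rw [e]
  exact MeasurableSet.biUnion hDc fun q _ =>
    measurableSet_predictable_Ioi_prod (X.measurableSet_inter_T_le hA q)

theorem measurableSet_predictable_le_T (X : MarkedPointProcess P E) (n : ℕ) :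
    MeasurableSet[X.filtration.predictable] {p : ℝ≥0 × Ω | p.1 ≤ X.T n p.2} := by
  have h := (X.measurableSet_predictable_T_lt (n := n) MeasurableSet.univ).compl
  have e : {p : ℝ≥0 × Ω | X.T n p.2 < p.1 ∧ p.2 ∈ univ}ᶜ = {p : ℝ≥0 × Ω | p.1 ≤ X.T n p.2} := by
    ext p
    simp
  rwa [e] at h

theorem measurable_jumpIndex (X : MarkedPointProcess P E) :
    Measurable[X.filtration.predictable] X.jumpIndex := by
  refine measurable_nat_of_preimage_singleton fun n => ?_
  have e : X.jumpIndex ⁻¹' {n} =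
      ({p | p.1 ≤ X.T (n + 1) p.2} ∩ ⋂ m, ⋂ (_ : m < n), {p | p.1 ≤ X.T (m + 1) p.2}ᶜ) ∪
        -- Paths with infinitely many jumps before `t` have index `sInf ∅ = 0`.
        ({_p | n = 0} ∩ ⋂ m, {p | p.1 ≤ X.T (m + 1) p.2}ᶜ) := by
    ext p
    simp only [mem_preimage, mem_singleton_iff, mem_union, mem_inter_iff, mem_ofPred_eq, mem_iInter,
      mem_compl_iff]
    constructor
    · intro h
      by_cases hne : {m | p.1 ≤ X.T (m + 1) p.2}.Nonempty
      · left
        have h1 := Nat.sInf_mem hne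
        change X.jumpIndex p ∈ _ at h1
        rw [h] at h1
        exact ⟨h1, fun m hm hm' => Nat.notMem_of_lt_sInf (h ▸ hm : m < X.jumpIndex p) hm'⟩
      · right
        rw [not_nonempty_iff_eq_empty] at hne
        refine ⟨?_, fun m hm => ?_⟩
        · rw [← h, jumpIndex, hne, Nat.sInf_empty]
        · exact (hne ▸ hm : m ∈ (∅ : Set ℕ))
    · rintro (⟨h1, h2⟩ | ⟨h1, h2⟩)
      · exact IsLeast.csInf_eq ⟨h1, fun m hm => not_lt.1 fun hmn => h2 m hmn hm⟩
      · rw [jumpIndex, h1, Nat.sInf_eq_zero]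
        exact Or.inr (eq_empty_of_forall_notMem h2)
  rw [e]
  refine MeasurableSet.union ((X.measurableSet_predictable_le_T _).inter
    (MeasurableSet.iInter fun m => MeasurableSet.iInter fun _ =>
      (X.measurableSet_predictable_le_T _).compl)) ((MeasurableSet.const _).inter
    (MeasurableSet.iInter fun m => (X.measurableSet_predictable_le_T _).compl))

theorem measurable_fst_predictable (X : MarkedPointProcess P E) :
    Measurable[X.filtration.predictable] fun p : ℝ≥0 × Ω => p.1 := by
  refine measurable_of_Ioi fun q => ?_
  have : (Prod.fst ⁻¹' Ioi q : Set (ℝ≥0 × Ω)) = Ioi q ×ˢ univ := by ext; simp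
  exact this ▸ measurableSet_predictable_Ioi_prod MeasurableSet.univ

theorem measurable_predictable_indicator (X : MarkedPointProcess P E) {n : ℕ}
    {F : Ω × (ℝ≥0∞ × E) → ℝ} (hF : Measurable[(X.jumpSigma n).prod inferInstance] F) :
    Measurable[X.filtration.predictable.prod mE]
      ({a : (ℝ≥0 × Ω) × E | X.T n a.1.2 < a.1.1}.indicator fun a => F (a.1.2, (a.1.1, a.2))) := by
  have hS' : ∀ A, MeasurableSet[X.jumpSigma n] A → MeasurableSet[X.filtration.predictable.prod mE]
      {a : (ℝ≥0 × Ω) × E | X.T n a.1.2 < a.1.1 ∧ a.1.2 ∈ A} := fun A hA =>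
    (@measurable_fst (ℝ≥0 × Ω) E X.filtration.predictable mE) (X.measurableSet_predictable_T_lt hA)
  have hS : MeasurableSet[X.filtration.predictable.prod mE]
      {a : (ℝ≥0 × Ω) × E | X.T n a.1.2 < a.1.1} := by
    simpa using hS' univ MeasurableSet.univ
  have ht : Measurable[X.filtration.predictable] fun p : ℝ≥0 × Ω => (p.1 : ℝ≥0∞) :=
    measurable_coe_nnreal_ennreal.comp X.measurable_fst_predictable
  refine measurable_indicator_comp_of_restrict (mγ := (X.jumpSigma n).prod inferInstance)
    hS (Θ := fun a => (a.1.2, ((a.1.1 : ℝ≥0∞), a.2))) ?_ hF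
  have hval := @measurable_subtype_coe _ (X.filtration.predictable.prod mE)
    {a : (ℝ≥0 × Ω) × E | X.T n a.1.2 < a.1.1}
  refine Measurable.prodMk ?_ ?_
  · intro A hA
    refine ⟨_, hS' A hA, ?_⟩
    ext ⟨a, ha⟩
    exact ⟨fun h => h.2, fun h => ⟨ha, h⟩⟩
  · exact ((ht.comp (@measurable_fst (ℝ≥0 × Ω) E X.filtration.predictable mE)).prodMk
      (@measurable_snd (ℝ≥0 × Ω) E X.filtration.predictable mE)).comp hval

/-- Serves twice: to select `h n` by the number of past jumps, and to select the integrand by the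
unit interval containing `t`. -/
theorem isPredictable_of_countable (X : MarkedPointProcess P E) {ι : Type*} [Countable ι]
    [MeasurableSpace ι] [MeasurableSingletonClass ι] {J : ℝ≥0 × Ω → ι}
    (hJ : Measurable[X.filtration.predictable] J) {g : ι → ℝ≥0 → Ω → E → ℝ}
    (hg : ∀ i, X.IsPredictable (g i)) :
    X.IsPredictable fun t ω x => g (J (t, ω)) t ω x := by
  have h1 : Measurable[(inferInstance : MeasurableSpace ι).prod (X.filtration.predictable.prod mE)]
      fun q : ι × ((ℝ≥0 × Ω) × E) => g q.1 q.2.1.1 q.2.1.2 q.2.2 :=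
    measurable_uncurry_of_countable hg
  exact h1.comp ((hJ.comp (@measurable_fst (ℝ≥0 × Ω) E X.filtration.predictable mE)).prodMk
    measurable_id)

theorem isPredictable_integrand {X : MarkedPointProcess P E} {κ : ℕ → Ω → Measure (ℝ≥0∞ × E)}
    (hκ : ∀ n, X.IsRegularJumpLaw n (κ n)) {h : ℕ → Ω × (ℝ≥0∞ × E) → ℝ}
    (hh : ∀ n, Measurable[(X.jumpSigma n).prod inferInstance] (h n)) :
    X.IsPredictable (X.integrand κ h) := by
  classical
  refine X.isPredictable_of_countable X.measurable_jumpIndex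
    (g := fun n t ω x => if X.T n ω < t then
      h n (ω, (t, x)) - condMean (κ n ω) (fun z => h n (ω, z)) t else 0) fun n => ?_
  have hc : ∀ f : Ω × (ℝ≥0∞ × E) → ℝ≥0∞, Measurable[(X.jumpSigma n).prod inferInstance] f →
      Measurable[(X.jumpSigma n).prod inferInstance] fun q : Ω × (ℝ≥0∞ × E) =>
        condTail (κ n q.1) (fun z => f (q.1, z)) q.2.1 := fun f hf =>
    Measurable.comp (g := fun p : Ω × ℝ≥0∞ => condTail (κ n p.1) (fun z => f (p.1, z)) p.2)
      (f := fun q : Ω × (ℝ≥0∞ × E) => (q.1, q.2.1))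
      (measurable_condTail_sub (hκ n).isProbabilityMeasure (hκ n).measurable hf)
      ((@measurable_fst Ω (ℝ≥0∞ × E) (X.jumpSigma n) _).prodMk
        (measurable_fst.comp (@measurable_snd Ω (ℝ≥0∞ × E) (X.jumpSigma n) _)))
  have hF : Measurable[(X.jumpSigma n).prod inferInstance] fun q : Ω × (ℝ≥0∞ × E) =>
      h n q - condMean (κ n q.1) (fun z => h n (q.1, z)) q.2.1 :=
    (hh n).sub ((hc _ (ENNReal.measurable_ofReal.comp (hh n))).ennreal_toReal.sub
      (hc _ (ENNReal.measurable_ofReal.comp (hh n).neg)).ennreal_toReal)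
  have := X.measurable_predictable_indicator hF
  refine (congrArg (fun f => Measurable[X.filtration.predictable.prod mE] f) ?_).mp this
  ext a
  simp [indicator]

variable [IsProbabilityMeasure P]

/-- The representation of the martingale generated by an integrable random variable. -/
theorem exists_representation (X : MarkedPointProcess P E) {κ : ℕ → Ω → Measure (ℝ≥0∞ × E)}
    (hκ : ∀ n, X.IsRegularJumpLaw n (κ n)) {Y : Ω → ℝ} (hYi : Integrable Y P) :
    ∃ (g : ℝ≥0 → Ω → E → ℝ) (c : Ω → ℝ), X.IsPredictable g ∧
      (∀ᵐ ω ∂P, ∀ t, X.QIntegrable κ ω t fun z => g z.1 ω z.2) ∧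
      ∀ t, ∀ᵐ ω ∂P, (P[Y | X.filtration t]) ω =
        c ω + X.qIntegral κ ω t fun z => g z.1 ω z.2 := by
  obtain ⟨h, hY⟩ := X.exists_isJumpVersion Y
  refine ⟨X.integrand κ h, P[Y | X.markSigma 0], isPredictable_integrand hκ hY.measurable, ?_, ?_⟩
  · filter_upwards [hY.ae_isRegularPath hYi hκ] with ω hω t
    obtain ⟨n, h1, h2⟩ := hω.exists_le_lt t
    exact (hω.qIntegral_eq (X.isIntegrand_integrand κ h ω) h1 h2).1
  · intro t
    filter_upwards [hY.ae_isRegularPath hYi hκ,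
      ae_all_iff.2 fun n => hY.ae_condExp_filtration_eq hYi hκ n t] with ω hω h3
    obtain ⟨n, h1, h2⟩ := hω.exists_le_lt t
    rw [(hω.qIntegral_eq (X.isIntegrand_integrand κ h ω) h1 h2).2, h3 n h1 h2]
    ring

end MarkedPointProcess

/-! ### Gluing over unit intervals and the theorem. -/

section Concat

variable {E : Type*} [MeasurableSpace E] {p : Measure (ℝ≥0 × E)} {s t : ℝ≥0} {G g : ℝ≥0 × E → ℝ}

theorem setIntegral_Ioc_concat (hst : s ≤ t) (hG : IntegrableOn G (Ioc 0 s ×ˢ univ) p)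
    (hg : IntegrableOn g (Ioc 0 t ×ˢ univ) p) (h : EqOn G g (Ioc s t ×ˢ univ)) :
    IntegrableOn G (Ioc 0 t ×ˢ univ) p ∧ ∫ z in Ioc 0 t ×ˢ univ, G z ∂p =
      ∫ z in Ioc 0 s ×ˢ univ, G z ∂p +
        (∫ z in Ioc 0 t ×ˢ univ, g z ∂p - ∫ z in Ioc 0 s ×ˢ univ, g z ∂p) := by
  have hu : Ioc 0 t ×ˢ (univ : Set E) = Ioc 0 s ×ˢ univ ∪ Ioc s t ×ˢ univ := by
    rw [← union_prod, Ioc_union_Ioc_eq_Ioc zero_le hst]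
  have hm : MeasurableSet (Ioc s t ×ˢ (univ : Set E)) := measurableSet_Ioc.prod MeasurableSet.univ
  have hd : Disjoint (Ioc 0 s ×ˢ (univ : Set E)) (Ioc s t ×ˢ univ) :=
    disjoint_left.2 fun z hz hz' => absurd hz.1.2 (not_le.2 hz'.1.1)
  rw [hu] at hg ⊢
  have hg1 := hg.left_of_union
  have hg2 := hg.right_of_union
  have hG2 : IntegrableOn G (Ioc s t ×ˢ univ) p := hg2.congr_fun h.symm hm
  refine ⟨hG.union hG2, ?_⟩
  rw [setIntegral_union hd hm hG hG2, setIntegral_union hd hm hg1 hg2, setIntegral_congr_fun hm h]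
  ring

theorem tendsto_setIntegral_Ioc {u : ℕ → ℝ≥0} (hu : Antitone u) (hut : ∀ n, t ≤ u n)
    (hlim : Tendsto u atTop (𝓝 t)) (hG : IntegrableOn G (Ioc 0 (u 0) ×ˢ univ) p) :
    Tendsto (fun n => ∫ z in Ioc 0 (u n) ×ˢ univ, G z ∂p) atTop
      (𝓝 (∫ z in Ioc 0 t ×ˢ univ, G z ∂p)) := by
  have e : Ioc 0 t ×ˢ (univ : Set E) = ⋂ n, Ioc 0 (u n) ×ˢ univ := by
    ext z
    simp only [mem_prod, mem_Ioc, mem_univ, and_true, mem_iInter]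
    exact ⟨fun h n => ⟨h.1, h.2.trans (hut n)⟩,
      fun h => ⟨(h 0).1, ge_of_tendsto' hlim fun n => (h n).2⟩⟩
  rw [e]
  exact tendsto_setIntegral_of_antitone (fun n => measurableSet_Ioc.prod MeasurableSet.univ)
    (fun m n h => prod_mono (Ioc_subset_Ioc_right (hu h)) Subset.rfl) ⟨0, hG⟩

end Concat

namespace MarkedPointProcess

variable {Ω E : Type*} [mΩ : MeasurableSpace Ω] [mE : MeasurableSpace E] {P : Measure Ω}
  {X : MarkedPointProcess P E} {κ : ℕ → Ω → Measure (ℝ≥0∞ × E)} {ω : Ω} {s t : ℝ≥0}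
  {G g : ℝ≥0 × E → ℝ}

theorem QIntegrable.concat (hst : s ≤ t) (hG : X.QIntegrable κ ω s G) (hg : X.QIntegrable κ ω t g)
    (h : EqOn G g (Ioc s t ×ˢ univ)) :
    X.QIntegrable κ ω t G ∧ X.qIntegral κ ω t G =
      X.qIntegral κ ω s G + (X.qIntegral κ ω t g - X.qIntegral κ ω s g) := by
  obtain ⟨h1, h2⟩ := setIntegral_Ioc_concat hst hG.1 hg.1 h
  obtain ⟨h3, h4⟩ := setIntegral_Ioc_concat hst hG.2 hg.2 h
  refine ⟨⟨h1, h3⟩, ?_⟩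
  rw [qIntegral, qIntegral, qIntegral, qIntegral, h2, h4]
  ring

theorem qIntegrable_zero (X : MarkedPointProcess P E) (κ : ℕ → Ω → Measure (ℝ≥0∞ × E)) (ω : Ω)
    (G : ℝ≥0 × E → ℝ) : X.QIntegrable κ ω 0 G := by
  simp [QIntegrable]

theorem qIntegral_zero (X : MarkedPointProcess P E) (κ : ℕ → Ω → Measure (ℝ≥0∞ × E)) (ω : Ω)
    (G : ℝ≥0 × E → ℝ) : X.qIntegral κ ω 0 G = 0 := by
  simp [qIntegral]

theorem tendsto_qIntegral {u : ℕ → ℝ≥0} (hu : Antitone u) (hut : ∀ n, t ≤ u n)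
    (hlim : Tendsto u atTop (𝓝 t)) (hG : X.QIntegrable κ ω (u 0) G) :
    Tendsto (fun n => X.qIntegral κ ω (u n) G) atTop (𝓝 (X.qIntegral κ ω t G)) :=
  (tendsto_setIntegral_Ioc hu hut hlim hG.1).sub (tendsto_setIntegral_Ioc hu hut hlim hG.2)

theorem measurable_ceil_predictable [BlackwellSpace E] (X : MarkedPointProcess P E) :
    Measurable[X.filtration.predictable] fun p : ℝ≥0 × Ω => ⌈p.1⌉₊ :=
  Nat.measurable_ceil.comp X.measurable_fst_predictable

end MarkedPointProcess

theorem mainTheorem4 {Ω E : Type*} [MeasurableSpace Ω] [MeasurableSpace E] [BlackwellSpace E]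
    (P : Measure Ω) [IsProbabilityMeasure P] (X : MarkedPointProcess P E)
    (κ : ℕ → Ω → Measure (ℝ≥0∞ × E)) (hκ : ∀ n, X.IsRegularJumpLaw n (κ n))
    (M : ℝ≥0 → Ω → ℝ) (hM : Martingale M X.filtration P) (hM2 : ∀ t, MemLp (M t) 2 P) :
    ∃ g : ℝ≥0 → Ω → E → ℝ, X.IsPredictable g ∧
      (∀ᵐ ω ∂P, ∀ t, X.QIntegrable κ ω t fun z => g z.1 ω z.2) ∧
      (∀ t, ∀ᵐ ω ∂P, M t ω = M 0 ω + X.qIntegral κ ω t fun z => g z.1 ω z.2) ∧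
      ((∀ᵐ ω ∂P, ∀ t, ContinuousWithinAt (fun s => M s ω) (Ici t) t) →
        ∀ᵐ ω ∂P, ∀ t, M t ω = M 0 ω + X.qIntegral κ ω t fun z => g z.1 ω z.2) := by
  -- Up to time `N`, the martingale is closed by `M N`.
  choose g c hg hgi hgM using fun N : ℕ =>
    X.exists_representation hκ ((hM2 N).integrable one_le_two)
  have hrep : ∀ (N : ℕ) (t : ℝ≥0), t ≤ N → ∀ᵐ ω ∂P,
      M t ω = c N ω + X.qIntegral κ ω t fun z => g N z.1 ω z.2 := by
    intro N t ht
    filter_upwards [hM.2 t N ht, hgM N t] with ω h1 h2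
    rw [← h1, h2]
  -- On `]k, k + 1]` the ceiling is `k + 1`, so there `G` is the integrand built from `M (k + 1)`.
  set G : ℝ≥0 → Ω → E → ℝ := fun t ω x => g ⌈t⌉₊ t ω x with hGdef
  have hG : X.IsPredictable G :=
    X.isPredictable_of_countable (g := fun N => g N) X.measurable_ceil_predictable hg
  have hEq : ∀ (k : ℕ) (t : ℝ≥0) (ω : Ω), t ≤ (k + 1 : ℕ) →
      EqOn (fun z : ℝ≥0 × E => G z.1 ω z.2) (fun z => g (k + 1) z.1 ω z.2)
        (Ioc (k : ℝ≥0) t ×ˢ univ) := by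
    intro k t ω ht z hz
    have : ⌈z.1⌉₊ = k + 1 := (Nat.ceil_eq_iff k.succ_ne_zero).2 ⟨by simpa using hz.1.1, hz.1.2.trans ht⟩
    simp only [hGdef, this]
  have hQk : ∀ ω, (∀ N t, X.QIntegrable κ ω t fun z => g N z.1 ω z.2) →
      ∀ k : ℕ, X.QIntegrable κ ω k fun z => G z.1 ω z.2 := by
    intro ω hω k
    induction k with
    | zero => simpa using X.qIntegrable_zero κ ω _
    | succ k ih =>
      exact (ih.concat (by exact_mod_cast k.le_succ) (hω (k + 1) _) (hEq k _ ω le_rfl)).1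
  have hQ : ∀ᵐ ω ∂P, ∀ t, X.QIntegrable κ ω t fun z => G z.1 ω z.2 := by
    filter_upwards [ae_all_iff.2 hgi] with ω hω t
    obtain ⟨k, hk⟩ := exists_nat_ge t
    have hsub : Ioc 0 t ×ˢ (univ : Set E) ⊆ Ioc 0 (k : ℝ≥0) ×ˢ univ :=
      prod_mono (Ioc_subset_Ioc_right hk) Subset.rfl
    exact ⟨(hQk ω hω k).1.mono_set hsub, (hQk ω hω k).2.mono_set hsub⟩
  have hstep : ∀ (k : ℕ) (t : ℝ≥0), k ≤ t → t ≤ (k + 1 : ℕ) →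
      (∀ᵐ ω ∂P, M k ω = M 0 ω + X.qIntegral κ ω k fun z => G z.1 ω z.2) →
      ∀ᵐ ω ∂P, M t ω = M 0 ω + X.qIntegral κ ω t fun z => G z.1 ω z.2 := by
    intro k t hkt ht hk
    -- The representation by `g (k + 1)` is used at both `t` and `k`; in the difference the initial
    -- value `c (k + 1)` cancels.
    filter_upwards [hk, hQ, ae_all_iff.2 hgi, hrep (k + 1) t ht,
      hrep (k + 1) k (by exact_mod_cast k.le_succ)] with ω h1 h2 h3 h4 h5
    rw [((h2 k).concat hkt (h3 (k + 1) t) (hEq k t ω ht)).2]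
    linarith
  have hnat : ∀ k : ℕ, ∀ᵐ ω ∂P, M k ω = M 0 ω + X.qIntegral κ ω k fun z => G z.1 ω z.2 := by
    intro k
    induction k with
    | zero =>
      refine ae_of_all _ fun ω => ?_
      simp [X.qIntegral_zero]
    | succ k ih => exact hstep k _ (by exact_mod_cast k.le_succ) le_rfl ih
  have hall : ∀ t, ∀ᵐ ω ∂P, M t ω = M 0 ω + X.qIntegral κ ω t fun z => G z.1 ω z.2 := fun t =>
    hstep ⌊t⌋₊ t (Nat.floor_le zero_le) (by exact_mod_cast (Nat.lt_floor_add_one t).le) (hnat _)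
  refine ⟨G, hG, hQ, hall, fun hrc => ?_⟩
  -- Both sides are right-continuous in `t`, so it suffices that they agree almost surely on a
  -- countable dense set, approached from the right.
  obtain ⟨D, hDc, hD⟩ := TopologicalSpace.exists_countable_dense ℝ≥0
  filter_upwards [hrc, hQ, (ae_ball_iff hDc).2 fun t _ => hall t] with ω h1 h2 h3 t
  obtain ⟨u, hu, hut, hlim⟩ := hD.exists_seq_strictAnti_tendsto t
  have hM1 : Tendsto (fun n => M (u n) ω) atTop (𝓝 (M t ω)) :=
    (h1 t).tendsto.comp (tendsto_nhdsWithin_iff.2 ⟨hlim, Eventually.of_forall fun n => mem_Ici.2 (hut n).1.le⟩)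
  have hq := X.tendsto_qIntegral (κ := κ) hu.antitone (fun n => (hut n).1.le) hlim (h2 (u 0))
  refine tendsto_nhds_unique hM1 ((hq.const_add (M 0 ω)).congr fun n => ?_)
  exact (h3 (u n) (hut n).2).symm
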